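/- Let $K$ be a field, let $q\in K^*$ be not a root of unity, let $n$ be a non-zero integer and let $f(k)=\sum_i a_ik^i\in K[k,k^{-1}]$ be a Laurent polynomial with $a_n=0$. Let $A=K[c,k^{\pm1}]$, let $\alpha$ be the $K$-automorphism of $A$ with $\alpha(k)=q^2k$ and $\alpha(c)=c$, and put $u=ck^n+f(k)$. Let $R$ be the augmented down-up algebra with these data, that is, the ambiskew polynomial algebra $R(A,\alpha,u-\alpha(u),1)$ generated over $A$ by $x$ and $y$ subject to the relations $$ya=\alpha(a)y,\qquad xa=\alpha^{-1}(a)x\quad(a\in A),\qquad xy=yx+u-\alpha(u),$$ and let $z=xy-u$. Then: (i) the centre $Z(R)$ is the polynomial algebra $K[c,z]$ in the two indeterminates $c$ and $z$; (ii) every non-zero (two-sided) ideal of $R$ has non-zero intersection with $Z(R)$; (iii) the localization of $R$ at $Z(R)\setminus\{0\}$ is a simple ring; (iv) $R$ is a unique factorization domain in the sense of Chatters: $R$ is a left and right Noetherian domain, it has at least one height one prime ideal, and every height one prime ideal $P$ of $R$ has the form $P=pR=Rp$ for some $p\in R$, with $R/P$ a domain. -/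

import Mathlib

open scoped LaurentPolynomial Polynomial

noncomputable section

/-! ### Ambiskew polynomial algebras -/

/-- Generators of the ambiskew polynomial algebra over `A`: the elements of `A`, and `x`, `y`. -/
inductive AmbiskewGen (A : Type*) : Type _
  | coeff (a : A) : AmbiskewGen A
  | x : AmbiskewGen A
  | y : AmbiskewGen A

/-- The defining relations of `R(A, α, v, ρ)`. The first three make the map from `A` a homomorphism
of `K`-algebras; the others are `y a = α(a) y`, `x a = α⁻¹(a) x` and `x y = ρ y x + v`. -/
inductive AmbiskewRel {K A : Type*} [Field K] [CommRing A] [Algebra K A]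
    (α : A ≃ₐ[K] A) (v : A) (ρ : Kˣ) :
    FreeAlgebra K (AmbiskewGen A) → FreeAlgebra K (AmbiskewGen A) → Prop
  | scalar (r : K) : AmbiskewRel α v ρ
      (FreeAlgebra.ι K (.coeff (algebraMap K A r)))
      (algebraMap K (FreeAlgebra K (AmbiskewGen A)) r)
  | add (a b : A) : AmbiskewRel α v ρ
      (FreeAlgebra.ι K (.coeff (a + b)))
      (FreeAlgebra.ι K (.coeff a) + FreeAlgebra.ι K (.coeff b))
  | mul (a b : A) : AmbiskewRel α v ρ
      (FreeAlgebra.ι K (.coeff (a * b)))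
      (FreeAlgebra.ι K (.coeff a) * FreeAlgebra.ι K (.coeff b))
  | y_coeff (a : A) : AmbiskewRel α v ρ
      (FreeAlgebra.ι K .y * FreeAlgebra.ι K (.coeff a))
      (FreeAlgebra.ι K (.coeff (α a)) * FreeAlgebra.ι K .y)
  | x_coeff (a : A) : AmbiskewRel α v ρ
      (FreeAlgebra.ι K .x * FreeAlgebra.ι K (.coeff a))
      (FreeAlgebra.ι K (.coeff (α.symm a)) * FreeAlgebra.ι K .x)
  | x_y : AmbiskewRel α v ρ
      (FreeAlgebra.ι K .x * FreeAlgebra.ι K .y)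
      ((ρ : K) • (FreeAlgebra.ι K .y * FreeAlgebra.ι K .x) + FreeAlgebra.ι K (.coeff v))

/-- The ambiskew polynomial algebra `R(A, α, v, ρ)` over a commutative `K`-algebra `A`, that is,
the iterated skew polynomial algebra `A[y; α][x; β, δ]` with `β = α⁻¹` on `A`, `β(y) = ρ y`,
`δ(A) = 0` and `δ(y) = v`, given by generators and relations over `A`. -/
def AmbiskewAlgebra {K A : Type*} [Field K] [CommRing A] [Algebra K A]
    (α : A ≃ₐ[K] A) (v : A) (ρ : Kˣ) : Type _ :=
  RingQuot (AmbiskewRel α v ρ)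

namespace AmbiskewAlgebra

variable {K A : Type*} [Field K] [CommRing A] [Algebra K A]
  (α : A ≃ₐ[K] A) (v : A) (ρ : Kˣ)

instance : Ring (AmbiskewAlgebra α v ρ) :=
  inferInstanceAs (Ring (RingQuot (AmbiskewRel α v ρ)))

instance : Algebra K (AmbiskewAlgebra α v ρ) :=
  inferInstanceAs (Algebra K (RingQuot (AmbiskewRel α v ρ)))

/-- The image in `R(A, α, v, ρ)` of a generator. -/
def gen (g : AmbiskewGen A) : AmbiskewAlgebra α v ρ :=
  RingQuot.mkAlgHom K (AmbiskewRel α v ρ) (FreeAlgebra.ι K g)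

/-- The element `x`. -/
def x : AmbiskewAlgebra α v ρ := gen α v ρ .x

/-- The element `y`. -/
def y : AmbiskewAlgebra α v ρ := gen α v ρ .y

/-- The structure map `A → R(A, α, v, ρ)`. -/
def ofCoeff : A →ₐ[K] AmbiskewAlgebra α v ρ :=
  AlgHom.ofLinearMap
    { toFun := fun a => gen α v ρ (.coeff a)
      map_add' := fun a b =>
        (RingQuot.mkAlgHom_rel K (AmbiskewRel.add a b)).trans (map_add _ _ _)
      map_smul' := fun r a => by
        rw [Algebra.smul_def, Algebra.smul_def]
        refine (RingQuot.mkAlgHom_rel K (AmbiskewRel.mul _ a)).trans ((map_mul _ _ _).trans ?_)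
        refine congrArg₂ (· * ·) ?_ rfl
        exact (RingQuot.mkAlgHom_rel K (AmbiskewRel.scalar r)).trans (AlgHom.commutes _ r) }
    (by
      refine (congrArg (gen α v ρ) (congrArg _ (map_one (algebraMap K A)).symm)).trans ?_
      refine (RingQuot.mkAlgHom_rel K (AmbiskewRel.scalar 1)).trans ?_
      rw [map_one, map_one]
      rfl)
    (fun a b => (RingQuot.mkAlgHom_rel K (AmbiskewRel.mul a b)).trans (map_mul _ _ _))

end AmbiskewAlgebra

/-! ### Augmented down-up algebras -/

namespace AugmentedDownUp

variable {K : Type*} [Field K]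

/-- The `K`-algebra endomorphism of `K[k, k⁻¹]` with `k ^ i ↦ p ^ i k ^ i` for every integer `i`;
here `k ^ i` is `T i`. -/
def scaleHom (p : Kˣ) : K[T;T⁻¹] →ₐ[K] K[T;T⁻¹] :=
  AddMonoidAlgebra.lift K K[T;T⁻¹] ℤ
    { toFun := fun i => LaurentPolynomial.C ((p ^ i.toAdd : Kˣ) : K) *
        LaurentPolynomial.T i.toAdd
      map_one' := by simp
      map_mul' := fun i j => by
        rw [toAdd_mul, zpow_add, Units.val_mul, map_mul, LaurentPolynomial.T_add]
        ring }

theorem scaleHom_T (p : Kˣ) (i : ℤ) :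
    scaleHom p (LaurentPolynomial.T i) =
      LaurentPolynomial.C ((p ^ i : Kˣ) : K) * LaurentPolynomial.T i :=
  (AddMonoidAlgebra.lift_single _ _ _).trans (one_smul _ _)

theorem scaleHom_comp (p p' : Kˣ) (h : p * p' = 1) :
    (scaleHom p).comp (scaleHom p') = AlgHom.id K K[T;T⁻¹] := by
  apply AlgHom.ext
  intro g
  induction g using LaurentPolynomial.induction_on' with
  | add a b ha hb => rw [map_add, map_add, ha, hb]
  | C_mul_T i r =>
    have hC : ∀ (p : Kˣ) (s : K), scaleHom p (LaurentPolynomial.C s) = LaurentPolynomial.C s :=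
      fun p s => (scaleHom p).commutes s
    have hp : ((p' ^ i : Kˣ) : K) * ((p ^ i : Kˣ) : K) = 1 := by
      rw [← Units.val_mul, ← mul_zpow, mul_comm p' p, h, one_zpow, Units.val_one]
    rw [AlgHom.comp_apply, map_mul, hC, scaleHom_T, map_mul, map_mul, hC, hC, scaleHom_T,
      ← mul_assoc, ← map_mul, ← mul_assoc, ← map_mul, mul_assoc r, hp, mul_one, AlgHom.id_apply]

/-- The `K`-algebra automorphism of `K[k, k⁻¹]` with `k ↦ p k`. -/
def scale (p : Kˣ) : K[T;T⁻¹] ≃ₐ[K] K[T;T⁻¹] :=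
  AlgEquiv.ofAlgHom (scaleHom p) (scaleHom p⁻¹)
    (scaleHom_comp p p⁻¹ (mul_inv_cancel p)) (scaleHom_comp p⁻¹ p (inv_mul_cancel p))

/-- The automorphism `α` of `A = K[c, k, k⁻¹]` with `α(k) = q² k` and `α(c) = c`.
Here `A` is `K[k, k⁻¹][c]`, so that `c` is `Polynomial.X` and `k ^ i` is
`Polynomial.C (LaurentPolynomial.T i)`. -/
def alpha (q : Kˣ) : K[T;T⁻¹][X] ≃ₐ[K] K[T;T⁻¹][X] :=
  Polynomial.mapAlgEquiv (scale (q ^ 2))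

/-- The element `u = c kⁿ + f(k)` of `A = K[c, k, k⁻¹]`. -/
def u (n : ℤ) (f : K[T;T⁻¹]) : K[T;T⁻¹][X] :=
  Polynomial.X * Polynomial.C (LaurentPolynomial.T n) + Polynomial.C f

end AugmentedDownUp

/-- The augmented down-up algebra `R(A, α, u - α(u), 1)` with `A = K[c, k, k⁻¹]`, `α(k) = q² k`,
`α(c) = c` and `u = c kⁿ + f(k)`. -/
abbrev AugmentedDownUpAlgebra {K : Type*} [Field K] (q : Kˣ) (n : ℤ) (f : K[T;T⁻¹]) : Type _ :=
  AmbiskewAlgebra (AugmentedDownUp.alpha q)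
    (AugmentedDownUp.u n f - AugmentedDownUp.alpha q (AugmentedDownUp.u n f)) 1

namespace AugmentedDownUpAlgebra

variable {K : Type*} [Field K] (q : Kˣ) (n : ℤ) (f : K[T;T⁻¹])

/-- The element `c`. -/
def c : AugmentedDownUpAlgebra q n f := AmbiskewAlgebra.ofCoeff _ _ _ Polynomial.X

/-- The Casimir element `z = x y - u`. -/
def z : AugmentedDownUpAlgebra q n f :=
  AmbiskewAlgebra.x _ _ _ * AmbiskewAlgebra.y _ _ _ -
    AmbiskewAlgebra.ofCoeff _ _ _ (AugmentedDownUp.u n f)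

end AugmentedDownUpAlgebra

/-! ### Noncommutative unique factorization domains -/

/-- A prime ideal of a (not necessarily commutative) ring: a proper two-sided ideal `P` such that
`a R b ⊆ P` implies `a ∈ P` or `b ∈ P`. -/
structure TwoSidedIdeal.IsPrimeIdeal {R : Type*} [Ring R] (P : TwoSidedIdeal R) : Prop where
  ne_top : P ≠ ⊤
  mem_or_mem : ∀ a b : R, (∀ r : R, a * r * b ∈ P) → a ∈ P ∨ b ∈ P

/-- A height one prime ideal: its height in the poset of all prime two-sided ideals is `1`. -/
def TwoSidedIdeal.IsHeightOnePrime {R : Type*} [Ring R] (P : TwoSidedIdeal R) : Prop :=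
  ∃ hP : P.IsPrimeIdeal,
    Order.height (⟨P, hP⟩ : {Q : TwoSidedIdeal R // Q.IsPrimeIdeal}) = 1

/-- A (noncommutative) unique factorization domain in the sense of Chatters: a left and right
Noetherian domain `R` with at least one height one prime ideal, such that every height one prime
ideal `P` has the form `P = pR = Rp` for some `p`, and `R/P` is a domain. -/
structure IsChattersUFD (R : Type*) [Ring R] : Prop where
  isDomain : IsDomain R
  left_noetherian : IsNoetherianRing R
  right_noetherian : IsNoetherianRing Rᵐᵒᵖ
  exists_heightOne : ∃ P : TwoSidedIdeal R, P.IsHeightOnePrime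
  heightOne_principal : ∀ P : TwoSidedIdeal R, P.IsHeightOnePrime →
    IsDomain P.ringCon.Quotient ∧
      ∃ p : R, (∀ a : R, a ∈ P ↔ ∃ r, a = p * r) ∧ (∀ a : R, a ∈ P ↔ ∃ r, a = r * p)

end

/-! Write `C = K[c, z]`. The elements `c` and `z` are central, `x y = w` with `w = z + c kⁿ + f(k)`,
and `y x = w(q² k)`. So for any commutative `K`-algebra `L` with chosen values of `c` and `z`, one
may send `y` to the unit of a skew Laurent ring over `L[k, k⁻¹]` and `x` to `y⁻¹`, with coefficient
`w`. Over `C[k, k⁻¹]` the algebra is spanned by the powers of `y` and of `x`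
(`normalForm_surjective`), whose images have distinct degrees. Hence, if `L` is a domain and `w ≠ 0`
over `L`, a normal form maps to zero only if all its coefficients do
(`map_eq_zero_of_toSkewLaurent_eq_zero`). For `L = C` this gives an embedding into a domain; for `L
= C/(p)` with `p` prime it shows that `pR` is the kernel of a map to a domain. In the second case `w
≠ 0` because its coefficients `c` and `z + a₀` have no common prime factor.

Centre: commuting with `k` forces degree `0` in `y`, and commuting with `y` then forbids powers of
`k`, as `q²` is not a root of unity.

Ideals: a power of `y` moves a non-zero element of `I` into `C[k, k⁻¹][y]`. Its monomials have
distinct weights, so it can be shortened inside `I` to some `s yᵐ` with `0 ≠ s ∈ C`. Multiplying by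
`x` on the left and on the right gives `s w yᵐ⁻¹` and `s w(q²ᵐ k) yᵐ⁻¹`. Modulo `w` and its
translate, `c` and `z` become Laurent polynomials in `k` over `K`, and two of these are
algebraically dependent. So some non-zero `P ∈ C` is a combination of both, `s P yᵐ⁻¹ ∈ I`, and `m`
descends to `0`.

Simplicity of the localization follows. A non-zero prime ideal meets `C`, hence contains a prime `p`
of `C` and the completely prime ideal `pR`; so height one primes are of the form `pR`. Noetherianity
comes from a skew Hilbert basis theorem used twice, and from the anti-automorphism exchanging `x`
and `y`. -/

/-! ### A noncommutative Hilbert basis theorem -/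

namespace SkewHilbert

variable {R : Type*} [Ring R] (S : Subring R) (t : R)

/-- The additive subgroup `∑_{i < n} t ^ i S`. -/
def filt : ℕ → AddSubgroup R
  | 0 => ⊥
  | n + 1 => filt n ⊔ S.toAddSubgroup.map (AddMonoidHom.mulLeft (t ^ n))

variable {S t}

theorem mem_filt_succ {n : ℕ} {r : R} :
    r ∈ filt S t (n + 1) ↔ ∃ a ∈ filt S t n, ∃ s ∈ S, a + t ^ n * s = r := by
  simp [filt, AddSubgroup.mem_sup]

theorem filt_le_succ (n : ℕ) : filt S t n ≤ filt S t (n + 1) := le_sup_left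

theorem filt_mono : Monotone (filt S t) := monotone_nat_of_le_succ filt_le_succ

theorem pow_mul_mem_filt (n : ℕ) {s : R} (hs : s ∈ S) : t ^ n * s ∈ filt S t (n + 1) :=
  mem_filt_succ.2 ⟨0, zero_mem _, s, hs, zero_add _⟩

theorem gen_mul_mem_filt (n : ℕ) {r : R} (hr : r ∈ filt S t n) : t * r ∈ filt S t (n + 1) := by
  induction n generalizing r with
  | zero => simp only [filt, AddSubgroup.mem_bot] at hr; simp [hr, zero_mem]
  | succ n ih =>
    obtain ⟨a, ha, s, hs, rfl⟩ := mem_filt_succ.1 hr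
    rw [mul_add, ← mul_assoc, ← pow_succ']
    exact add_mem (filt_le_succ _ (ih ha)) (pow_mul_mem_filt _ hs)

theorem filt_mul_mem (n : ℕ) {r s : R} (hr : r ∈ filt S t n) (hs : s ∈ S) :
    r * s ∈ filt S t n := by
  induction n generalizing r with
  | zero => simp only [filt, AddSubgroup.mem_bot] at hr; simp [hr, zero_mem]
  | succ n ih =>
    obtain ⟨a, ha, s', hs', rfl⟩ := mem_filt_succ.1 hr
    rw [add_mul, mul_assoc]
    exact mem_filt_succ.2 ⟨_, ih ha, _, mul_mem hs' hs, rfl⟩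

section

variable (h₁ : ∀ s ∈ S, ∃ s' ∈ S, ∃ s'' ∈ S, s * t = t * s' + s'')

include h₁ in
-- Each exchange of a coefficient with `t` produces an error without `t`, so the total error has
-- lower degree. This makes the filtration stable under left multiplication by `S`.
theorem exists_mul_pow_sub_mem (n : ℕ) {s : R} (hs : s ∈ S) :
    ∃ s' ∈ S, s * t ^ n - t ^ n * s' ∈ filt S t n := by
  induction n generalizing s with
  | zero => exact ⟨s, hs, by simp [zero_mem]⟩
  | succ n ih =>
    obtain ⟨s', hs', s'', hs'', h⟩ := h₁ s hs
    obtain ⟨a, ha, ha'⟩ := ih hs'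
    obtain ⟨b, hb, hb'⟩ := ih hs''
    refine ⟨a, ha, ?_⟩
    have : s * t ^ (n + 1) - t ^ (n + 1) * a =
        t * (s' * t ^ n - t ^ n * a) + ((s'' * t ^ n - t ^ n * b) + t ^ n * b) := by
      rw [pow_succ', ← mul_assoc, h]; noncomm_ring
    rw [this]
    exact add_mem (gen_mul_mem_filt _ ha') (add_mem (filt_le_succ _ hb') (pow_mul_mem_filt _ hb))

include h₁ in
theorem mul_filt_mem (n : ℕ) {r s : R} (hs : s ∈ S) (hr : r ∈ filt S t n) :
    s * r ∈ filt S t n := by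
  induction n generalizing r with
  | zero => simp only [filt, AddSubgroup.mem_bot] at hr; simp [hr, zero_mem]
  | succ n ih =>
    obtain ⟨a, ha, s', hs', rfl⟩ := mem_filt_succ.1 hr
    obtain ⟨b, hb, hb'⟩ := exists_mul_pow_sub_mem h₁ n hs
    have : s * (a + t ^ n * s') =
        s * a + ((s * t ^ n - t ^ n * b) * s' + t ^ n * (b * s')) := by noncomm_ring
    rw [this]
    exact add_mem (filt_le_succ _ (ih ha)) (add_mem (filt_le_succ _ (filt_mul_mem _ hb' hs'))
      (pow_mul_mem_filt _ (mul_mem hb hs')))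

variable (h₂ : ∀ s ∈ S, ∃ s' ∈ S, ∃ s'' ∈ S, t * s = s' * t + s'')

include h₁ h₂ in
-- Coefficients stand to the right of `t ^ n`, whereas the ideals are left ideals. This reverse
-- exchange realises left multiplication of a leading coefficient by `s`, so that leading
-- coefficients form a left ideal.
theorem exists_sub_pow_mul_mem (n : ℕ) {s : R} (hs : s ∈ S) :
    ∃ s' ∈ S, s' * t ^ n - t ^ n * s ∈ filt S t n := by
  induction n with
  | zero => exact ⟨s, hs, by simp [zero_mem]⟩
  | succ n ih =>
    obtain ⟨a, ha, ha'⟩ := ih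
    obtain ⟨s', hs', s'', hs'', h⟩ := h₂ a ha
    refine ⟨s', hs', ?_⟩
    have : s' * t ^ (n + 1) - t ^ (n + 1) * s =
        t * (a * t ^ n - t ^ n * s) - s'' * t ^ n := by
      have h' : t * (a * t ^ n - t ^ n * s) = (t * a) * t ^ n - t ^ (n + 1) * s := by
        rw [pow_succ']; noncomm_ring
      rw [h', h, pow_succ' t n]; noncomm_ring
    rw [this]
    refine sub_mem (gen_mul_mem_filt _ ha') (mul_filt_mem h₁ _ hs'' ?_)
    simpa using pow_mul_mem_filt (t := t) n (one_mem S)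

include h₁ in
theorem exists_mem_filt (hgen : Subring.closure (insert t (S : Set R)) = ⊤) (r : R) :
    ∃ n, r ∈ filt S t n := by
  have key : ∀ a ∈ Subring.closure (insert t (S : Set R)),
      ∀ r, (∃ n, r ∈ filt S t n) → ∃ n, a * r ∈ filt S t n := by
    intro a ha
    induction ha using Subring.closure_induction with
    | mem a ha =>
      rintro r ⟨n, hr⟩
      rcases ha with rfl | ha
      · exact ⟨_, gen_mul_mem_filt _ hr⟩
      · exact ⟨_, mul_filt_mem h₁ _ ha hr⟩
    | zero => exact fun r _ => ⟨0, by simp [zero_mem]⟩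
    | one => simp
    | add a b _ _ iha ihb =>
      intro r hr
      obtain ⟨m, hm⟩ := iha r hr
      obtain ⟨n, hn⟩ := ihb r hr
      exact ⟨max m n, by
        rw [add_mul]
        exact add_mem (filt_mono (le_max_left _ _) hm) (filt_mono (le_max_right _ _) hn)⟩
    | neg a _ iha =>
      intro r hr
      obtain ⟨m, hm⟩ := iha r hr
      exact ⟨m, by rw [neg_mul]; exact neg_mem hm⟩
    | mul a b _ _ iha ihb =>
      intro r hr
      obtain ⟨m, hm⟩ := iha _ (ihb r hr)
      exact ⟨m, by rwa [mul_assoc]⟩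
  simpa using key r (by rw [hgen]; trivial) 1
    ⟨1, by simpa using pow_mul_mem_filt (t := t) 0 (one_mem S)⟩

/-- The left ideal of `S` of leading coefficients of the elements of degree `n` of a left ideal. -/
def lead (h₁ : ∀ s ∈ S, ∃ s' ∈ S, ∃ s'' ∈ S, s * t = t * s' + s'')
    (h₂ : ∀ s ∈ S, ∃ s' ∈ S, ∃ s'' ∈ S, t * s = s' * t + s'')
    (I : Submodule R R) (n : ℕ) : Submodule S S where
  carrier := {s | ∃ a ∈ filt S t n, a + t ^ n * s ∈ I}
  add_mem' := by
    rintro s s' ⟨a, ha, h⟩ ⟨a', ha', h'⟩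
    refine ⟨a + a', add_mem ha ha', ?_⟩
    convert add_mem h h' using 1
    push_cast
    noncomm_ring
  zero_mem' := ⟨0, zero_mem _, by simp⟩
  smul_mem' := by
    rintro s₀ s ⟨a, ha, h⟩
    obtain ⟨b, hb, hb'⟩ := exists_sub_pow_mul_mem h₁ h₂ n s₀.2
    refine ⟨b * a + (b * t ^ n - t ^ n * s₀) * s,
      add_mem (mul_filt_mem h₁ _ hb ha) (filt_mul_mem _ hb' s.2), ?_⟩
    convert I.smul_mem b h using 1
    simp only [smul_eq_mul, Subring.coe_mul]
    noncomm_ring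

theorem lead_mono {I I' : Submodule R R} (hI : I ≤ I') {m n : ℕ} (hmn : m ≤ n) :
    lead h₁ h₂ I m ≤ lead h₁ h₂ I' n := by
  induction n, hmn using Nat.le_induction with
  | base => exact fun s ⟨a, ha, h⟩ => ⟨a, ha, hI h⟩
  | succ n _ ih =>
    intro s hs
    obtain ⟨a, ha, h⟩ := ih hs
    refine ⟨t * a, gen_mul_mem_filt _ ha, ?_⟩
    convert I'.smul_mem t h using 1
    rw [smul_eq_mul, pow_succ']
    noncomm_ring

/-- Subtract from an element of `I'` an element of `I` with the same leading term and induct on the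
degree. -/
theorem eq_of_lead_eq (hgen : Subring.closure (insert t (S : Set R)) = ⊤) {I I' : Submodule R R}
    (hI : I ≤ I') (h : ∀ n, lead h₁ h₂ I n = lead h₁ h₂ I' n) : I = I' := by
  refine le_antisymm hI ?_
  have key : ∀ n, ∀ r ∈ filt S t n, r ∈ I' → r ∈ I := by
    intro n
    induction n with
    | zero => intro r hr _; simp only [filt, AddSubgroup.mem_bot] at hr; simp [hr]
    | succ n ih =>
      intro r hr hrI
      obtain ⟨a, ha, s, hs, rfl⟩ := mem_filt_succ.1 hr
      have : (⟨s, hs⟩ : S) ∈ lead h₁ h₂ I n := by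
        rw [h]; exact ⟨a, ha, hrI⟩
      obtain ⟨a', ha', hs'⟩ := this
      have h' := ih (a - a') (sub_mem ha ha') (by
        convert sub_mem hrI (hI hs') using 1; simp)
      convert add_mem h' hs' using 1
      abel
  intro r hr
  obtain ⟨n, hn⟩ := exists_mem_filt h₁ hgen r
  exact key n r hn hr

/-- A ring generated by a left Noetherian subring `S` and an element `t` with `t S + S = S t + S`
is left Noetherian. -/
theorem isNoetherianRing [IsNoetherianRing S]
    (h₁ : ∀ s ∈ S, ∃ s' ∈ S, ∃ s'' ∈ S, s * t = t * s' + s'')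
    (h₂ : ∀ s ∈ S, ∃ s' ∈ S, ∃ s'' ∈ S, t * s = s' * t + s'')
    (hgen : Subring.closure (insert t (S : Set R)) = ⊤) : IsNoetherianRing R := by
  have hS := monotone_stabilizes_iff_noetherian.2 (inferInstance : IsNoetherian S S)
  refine monotone_stabilizes_iff_noetherian.1 fun I => ?_
  -- The leading ideals grow in both the index and the degree. The diagonal chain settles all
  -- indices and degrees from `N` on; each of the finitely many degrees `n < N` gets its own bound
  -- `M n`.
  obtain ⟨N, hN⟩ := hS ⟨fun j => lead h₁ h₂ (I j) j, fun i j hij => lead_mono h₁ h₂ (I.2 hij) hij⟩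
  have hM := fun n => hS
    ⟨fun j => lead h₁ h₂ (I j) n, fun i j hij => lead_mono h₁ h₂ (I.2 hij) le_rfl⟩
  choose M hM using hM
  replace hN : ∀ m, N ≤ m → lead h₁ h₂ (I N) N = lead h₁ h₂ (I m) m := hN
  replace hM : ∀ n m, M n ≤ m → lead h₁ h₂ (I (M n)) n = lead h₁ h₂ (I m) n := hM
  have hb : ∀ j n, N ≤ j → N ≤ n → lead h₁ h₂ (I j) n = lead h₁ h₂ (I N) N := fun j n hj hn =>
    le_antisymm
      ((lead_mono h₁ h₂ (I.2 (le_max_left j n)) (le_max_right j n)).trans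
        (hN _ (hj.trans (le_max_left j n))).ge)
      (lead_mono h₁ h₂ (I.2 hj) hn)
  refine ⟨max N ((Finset.range N).sup M), fun j hj => eq_of_lead_eq h₁ h₂ hgen (I.2 hj) fun n => ?_⟩
  rcases lt_or_ge n N with hn | hn
  · have hle : M n ≤ max N ((Finset.range N).sup M) :=
      (Finset.le_sup (Finset.mem_range.2 hn)).trans (le_max_right _ _)
    rw [← hM n _ hle, ← hM n _ (hle.trans hj)]
  · rw [hb _ _ (le_max_left _ _) hn, hb _ _ ((le_max_left _ _).trans hj) hn]

end

end SkewHilbert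

/-! ### Skew monoid algebras and Laurent polynomials -/

/-- A uniquely represented product of support elements gives a non-zero coefficient of `a * b`. The
twist does no harm, since a group acts by bijections. -/
instance SkewMonoidAlgebra.instNoZeroDivisors {k G : Type*} [Ring k] [NoZeroDivisors k] [Group G]
    [UniqueProds G] [MulSemiringAction G k] : NoZeroDivisors (SkewMonoidAlgebra k G) where
  eq_zero_or_eq_zero_of_mul_eq_zero {a b} hab := by
    classical
    contrapose! hab
    obtain ⟨da, ha, db, hb, h⟩ := UniqueProds.uniqueMul_of_nonempty
      (Finset.nonempty_iff_ne_empty.2 (mt support_eq_empty.1 hab.1))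
      (Finset.nonempty_iff_ne_empty.2 (mt support_eq_empty.1 hab.2))
    have hcoeff : (a * b).coeff (da * db) = a.coeff da * da • b.coeff db := by
      rw [coeff_mul, sum_def, Finsupp.sum, Finset.sum_eq_single da]
      · rw [sum_def, Finsupp.sum, Finset.sum_eq_single db]
        · simp
        · intro d hd hne
          exact if_neg fun he => hne (h ha hd he).2
        · intro hd
          exact absurd hb hd
      · intro d hd hne
        rw [sum_def, Finsupp.sum]
        refine Finset.sum_eq_zero fun d' hd' => if_neg fun he => hne (h hd hd' he).1
      · intro hd
        exact absurd ha hd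
    intro h0
    rw [h0, coeff_zero, Finsupp.zero_apply] at hcoeff
    have hne : da • b.coeff db ≠ 0 := fun h' =>
      mem_support_iff.1 hb ((smul_eq_zero_iff_eq da).1 h')
    exact mul_ne_zero (mem_support_iff.1 ha) hne hcoeff.symm

/-! ### Rescaling the variable of Laurent polynomials -/

namespace LaurentPolynomial

variable {L : Type*} [CommRing L]

/-- The `L`-algebra endomorphism of `L[T;T⁻¹]` with `T ↦ r T`. -/
noncomputable def rescale (r : Lˣ) : L[T;T⁻¹] →ₐ[L] L[T;T⁻¹] :=
  AddMonoidAlgebra.lift L L[T;T⁻¹] ℤ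
    { toFun := fun i => C ((r ^ i.toAdd : Lˣ) : L) * T i.toAdd
      map_one' := by simp
      map_mul' := fun i j => by
        rw [toAdd_mul, zpow_add, Units.val_mul, map_mul, T_add]
        ring }

theorem rescale_T (r : Lˣ) (i : ℤ) : rescale r (T i) = C ((r ^ i : Lˣ) : L) * T i :=
  (AddMonoidAlgebra.lift_single _ _ _).trans (one_smul _ _)

theorem rescale_C (r : Lˣ) (s : L) : rescale r (C s) = C s := (rescale r).commutes s

theorem coeff_C_mul_T (s : L) (i j : ℤ) :
    (C s * T i : L[T;T⁻¹]).coeff j = if i = j then s else 0 := by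
  classical
  rw [← single_eq_C_mul_T, AddMonoidAlgebra.coeff_single, Finsupp.single_apply]

theorem coeff_rescale (r : Lˣ) (g : L[T;T⁻¹]) (j : ℤ) :
    (rescale r g).coeff j = ((r ^ j : Lˣ) : L) * g.coeff j := by
  induction g using LaurentPolynomial.induction_on' with
  | add a b ha hb =>
    rw [map_add, AddMonoidAlgebra.coeff_add, AddMonoidAlgebra.coeff_add, Finsupp.add_apply,
      Finsupp.add_apply, ha, hb, mul_add]
  | C_mul_T i s =>
    rw [map_mul, rescale_C, rescale_T, ← mul_assoc, ← map_mul, coeff_C_mul_T, coeff_C_mul_T]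
    split_ifs with h
    · rw [h, mul_comm]
    · rw [mul_zero]

theorem rescale_one (g : L[T;T⁻¹]) : rescale 1 g = g := by
  apply LaurentPolynomial.ext
  intro j
  rw [coeff_rescale, one_zpow, Units.val_one, one_mul]

theorem rescale_mul (r s : Lˣ) (g : L[T;T⁻¹]) : rescale (r * s) g = rescale r (rescale s g) := by
  apply LaurentPolynomial.ext
  intro j
  rw [coeff_rescale, coeff_rescale, coeff_rescale, mul_zpow, Units.val_mul, mul_assoc]

theorem algebraMap_map_rescale {K : Type*} [CommRing K] [Algebra K L] (p : Kˣ) (g : K[T;T⁻¹]) :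
    AddMonoidAlgebra.mapRingHom ℤ (algebraMap K L) (rescale p g) =
      rescale (Units.map (algebraMap K L : K →* L) p) (AddMonoidAlgebra.mapRingHom ℤ (algebraMap K L) g) := by
  apply LaurentPolynomial.ext
  intro j
  rw [coeff_rescale]
  simp [coeff_rescale, ← map_zpow]

/-- `ℤ`, acting on Laurent polynomials over `K`-algebras by `T ↦ pⁱ T`. -/
def ScaleGroup {K : Type*} [Field K] (_ : Kˣ) : Type := Multiplicative ℤ

section

variable {K : Type*} [Field K] (p : Kˣ)

instance : CommGroup (ScaleGroup p) := inferInstanceAs (CommGroup (Multiplicative ℤ))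

instance : UniqueProds (ScaleGroup p) := inferInstanceAs (UniqueProds (Multiplicative ℤ))

/-- The group depends only on `p`; the scaling factor is carried to `L` by `algebraMap`, so one
group serves `K[c, z]` and all its quotients. -/
noncomputable instance [Algebra K L] : MulSemiringAction (ScaleGroup p) L[T;T⁻¹] where
  smul i g := rescale (Units.map (algebraMap K L : K →* L) (p ^ Multiplicative.toAdd i)) g
  one_smul g := by
    change rescale (Units.map (algebraMap K L : K →* L) (p ^ (0 : ℤ))) g = g
    rw [zpow_zero, map_one, rescale_one]
  mul_smul i j g := by
    change rescale (Units.map (algebraMap K L : K →* L) (p ^ (i.toAdd + j.toAdd : ℤ))) g = _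
    rw [zpow_add, map_mul, rescale_mul]
    rfl
  smul_zero i := map_zero _
  smul_add i := map_add _
  smul_one i := map_one _
  smul_mul i := map_mul _

variable {p}

/-- The element of `ScaleGroup p` acting by `T ↦ pⁱ T`. -/
def ScaleGroup.of (p : Kˣ) (i : ℤ) : ScaleGroup p := Multiplicative.ofAdd i

theorem ScaleGroup.of_add (i j : ℤ) :
    ScaleGroup.of p (i + j) = ScaleGroup.of p i * ScaleGroup.of p j := rfl

theorem ScaleGroup.of_zero : ScaleGroup.of p 0 = 1 := rfl

theorem ScaleGroup.of_injective : Function.Injective (ScaleGroup.of p) := fun _ _ h => h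

theorem ScaleGroup.exists_of (g : ScaleGroup p) : ∃ i, g = ScaleGroup.of p i := ⟨g, rfl⟩

theorem ScaleGroup.smul_def [Algebra K L] (i : ℤ) (g : L[T;T⁻¹]) :
    ScaleGroup.of p i • g = rescale (Units.map (algebraMap K L : K →* L) (p ^ i)) g := rfl

theorem ScaleGroup.smul_C [Algebra K L] (i : ℤ) (s : L) :
    ScaleGroup.of p i • (C s : L[T;T⁻¹]) = C s := rescale_C _ _

theorem ScaleGroup.coeff_smul [Algebra K L] (i j : ℤ) (g : L[T;T⁻¹]) :
    (ScaleGroup.of p i • g).coeff j = algebraMap K L ((p ^ (i * j) : Kˣ) : K) * g.coeff j := by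
  rw [ScaleGroup.smul_def, coeff_rescale, ← map_zpow, ← zpow_mul]
  rfl

end

/-- Two Laurent polynomials over a field are algebraically dependent. -/
theorem exists_aeval_eq_zero {K : Type*} [Field K] (g h : K[T;T⁻¹]) :
    ∃ P : MvPolynomial (Fin 2) K, P ≠ 0 ∧ MvPolynomial.aeval ![g, h] P = 0 := by
  by_contra! H
  have hind : AlgebraicIndependent K ![g, h] :=
    (injective_iff_map_eq_zero _).2 fun P hP => by
      by_contra hne
      exact H P hne hP
  have hT : IsScalarTower K K[X] K[T;T⁻¹] := IsScalarTower.of_algebraMap_eq fun r => by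
    rw [algebraMap_eq_toLaurent, Polynomial.algebraMap_apply, Polynomial.toLaurent_C]
    rfl
  have hinj : Function.Injective (algebraMap K[X] K[T;T⁻¹]) := by
    rw [show (algebraMap K[X] K[T;T⁻¹]) = Polynomial.toLaurent from RingHom.ext algebraMap_eq_toLaurent]
    exact Polynomial.toLaurent_injective
  have hF : FaithfulSMul K[X] K[T;T⁻¹] := (faithfulSMul_iff_algebraMap_injective _ _).2 hinj
  have halg : Algebra.IsAlgebraic K[X] K[T;T⁻¹] :=
    IsLocalization.isAlgebraic K[T;T⁻¹] (Submonoid.powers (Polynomial.X : K[X]))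
  -- As a localization of `K[X]`, the ring is algebraic over it and has transcendence degree one,
  -- too small for two independent elements.
  have h1 := _root_.trdeg_add_eq K K[X] (A := K[T;T⁻¹])
  rw [Polynomial.trdeg_of_isDomain, _root_.trdeg_eq_zero, add_zero] at h1
  have h2 := hind.lift_cardinalMk_le_trdeg
  rw [← h1] at h2
  simp at h2

instance {K : Type*} [Field K] : IsNoetherianRing K[T;T⁻¹] :=
  IsLocalization.isNoetherianRing (Submonoid.powers (Polynomial.X : K[X])) _ inferInstance

end LaurentPolynomial

/-! ### Localization at central elements -/

/-- If every non-zero ideal of a ring contains a non-zero central element, then the localization at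
the non-zero central elements is a simple ring. -/
theorem LocalizedModule.isSimpleRing_of_center {R : Type*} [Ring R] [IsDomain R]
    (S : Submonoid (Subring.center R)) (hS : ∀ s, s ∈ S ↔ s ≠ 0)
    (h : ∀ I : TwoSidedIdeal R, I ≠ ⊥ → ∃ r ∈ I, r ∈ Subring.center R ∧ r ≠ 0) :
    IsSimpleRing (LocalizedModule S R) := by
  -- In a domain no denominator kills a numerator, so the ring embeds in its localization.
  have hmk : ∀ {r : R} {s : S}, (mk r s : LocalizedModule S R) = 0 → r = 0 := by
    intro r s hr
    rw [← zero_mk 1, mk_eq] at hr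
    obtain ⟨u, hu⟩ := hr
    have hu0 : ((u : Subring.center R) : R) ≠ 0 := fun h0 => (hS u).1 u.2 (Subtype.ext h0)
    simp only [one_smul, smul_zero] at hu
    exact (mul_eq_zero.1 (show ((u : Subring.center R) : R) * r = 0 from hu)).resolve_left hu0
  let ι : R →+* LocalizedModule S R :=
    { toFun := fun r => mk r 1
      map_one' := OreLocalization.one_def.symm
      map_mul' := fun a b => by rw [mk_mul_mk, one_mul]
      map_zero' := zero_mk 1
      map_add' := fun a b => by rw [mk_add_mk]; simp }
  have hnt : Nontrivial (LocalizedModule S R) :=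
    ⟨⟨mk 1 1, 0, fun h0 => one_ne_zero (hmk h0)⟩⟩
  refine ⟨⟨fun I => or_iff_not_imp_left.2 fun hI => ?_⟩⟩
  -- Clearing denominators puts the numerator of a non-zero element of `I` into the contraction.
  have hJ : I.comap ι ≠ ⊥ := by
    intro hJ
    refine hI (eq_bot_iff.2 fun a ha => ?_)
    induction a using LocalizedModule.induction_on with
    | h r s =>
      have hr : r ∈ I.comap ι := by
        rw [TwoSidedIdeal.mem_comap]
        have := I.mul_mem_left (mk ((s : Subring.center R) : R) 1) _ ha
        rw [mk_mul_mk, one_mul] at this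
        have h2 : (mk r 1 : LocalizedModule S R) = mk (((s : Subring.center R) : R) * r) s :=
          (mk_cancel s r).symm
        change (mk r 1 : LocalizedModule S R) ∈ I
        rwa [h2]
      rw [hJ, TwoSidedIdeal.mem_bot] at hr
      rw [TwoSidedIdeal.mem_bot, hr, zero_mk]
  obtain ⟨r, hrI, hrc, hr0⟩ := h _ hJ
  -- The central element found in the contraction is itself an admissible denominator, so its image
  -- in `I` is a unit.
  let s : S := ⟨⟨r, hrc⟩, (hS _).2 fun h0 => hr0 (congrArg Subtype.val h0)⟩
  rw [TwoSidedIdeal.mem_comap] at hrI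
  have h1 := I.mul_mem_left (mk 1 s) _ hrI
  have h2 : (mk 1 s : LocalizedModule S R) * ι r = 1 := by
    change (mk 1 s : LocalizedModule S R) * mk r 1 = 1
    rw [mk_mul_mk, mul_one, one_mul]
    have := mk_cancel s (1 : R)
    rw [show s • (1 : R) = r from mul_one r] at this
    rw [this]
    exact OreLocalization.one_def.symm
  rw [h2] at h1
  exact (TwoSidedIdeal.one_mem_iff I).1 h1

/-! ### Ambiskew polynomial algebras: universal property, symmetry, Noetherianity -/

namespace AmbiskewAlgebra

variable {K A : Type*} [Field K] [CommRing A] [Algebra K A]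
  (α : A ≃ₐ[K] A) (v : A) (ρ : Kˣ)

theorem y_mul_ofCoeff (a : A) :
    y α v ρ * ofCoeff α v ρ a = ofCoeff α v ρ (α a) * y α v ρ :=
  (map_mul _ _ _).symm.trans ((RingQuot.mkAlgHom_rel K (AmbiskewRel.y_coeff a)).trans (map_mul _ _ _))

theorem x_mul_ofCoeff (a : A) :
    x α v ρ * ofCoeff α v ρ a = ofCoeff α v ρ (α.symm a) * x α v ρ :=
  (map_mul _ _ _).symm.trans ((RingQuot.mkAlgHom_rel K (AmbiskewRel.x_coeff a)).trans (map_mul _ _ _))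

theorem x_mul_y :
    x α v ρ * y α v ρ = (ρ : K) • (y α v ρ * x α v ρ) + ofCoeff α v ρ v := by
  refine (map_mul _ _ _).symm.trans ((RingQuot.mkAlgHom_rel K AmbiskewRel.x_y).trans ?_)
  rw [map_add, map_smul, map_mul]
  rfl

/-- The set of the images of the generators. -/
def generators : Set (AmbiskewAlgebra α v ρ) :=
  {x α v ρ, y α v ρ} ∪ Set.range (ofCoeff α v ρ)

theorem gen_mem_generators (g : AmbiskewGen A) : gen α v ρ g ∈ generators α v ρ := by
  cases g with
  | coeff a => exact Or.inr ⟨a, rfl⟩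
  | x => exact Or.inl (Or.inl rfl)
  | y => exact Or.inl (Or.inr rfl)

theorem closure_generators : Subring.closure (generators α v ρ) = ⊤ := by
  refine (Subring.eq_top_iff' _).2 fun r => ?_
  obtain ⟨w, rfl⟩ := RingQuot.mkAlgHom_surjective K (AmbiskewRel α v ρ) r
  induction w using FreeAlgebra.induction with
  | grade0 s =>
    refine Subring.subset_closure (Or.inr ⟨algebraMap K A s, ?_⟩)
    rw [AlgHom.commutes, AlgHom.commutes]
    rfl
  | grade1 g => exact Subring.subset_closure (gen_mem_generators α v ρ g)
  | mul a b ha hb => rw [map_mul]; exact mul_mem ha hb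
  | add a b ha hb => rw [map_add]; exact add_mem ha hb

variable {α v ρ} in
/-- The universal property of an ambiskew polynomial algebra. -/
def lift {B : Type*} [Ring B] [Algebra K B] (f : A →ₐ[K] B) (X Y : B)
    (hY : ∀ a, Y * f a = f (α a) * Y) (hX : ∀ a, X * f a = f (α.symm a) * X)
    (hXY : X * Y = (ρ : K) • (Y * X) + f v) : AmbiskewAlgebra α v ρ →ₐ[K] B :=
  RingQuot.liftAlgHom K ⟨FreeAlgebra.lift K fun g => match g with
    | .coeff a => f a
    | .x => X
    | .y => Y, by
      intro a b h
      cases h <;> simp_all [FreeAlgebra.lift_ι_apply]⟩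

section

variable {α v ρ} {B : Type*} [Ring B] [Algebra K B] (f : A →ₐ[K] B) (X Y : B)
    (hY : ∀ a, Y * f a = f (α a) * Y) (hX : ∀ a, X * f a = f (α.symm a) * X)
    (hXY : X * Y = (ρ : K) • (Y * X) + f v)

theorem lift_x : lift f X Y hY hX hXY (x α v ρ) = X :=
  (RingQuot.liftAlgHom_mkAlgHom_apply K _ _ _).trans (FreeAlgebra.lift_ι_apply _ _)

theorem lift_y : lift f X Y hY hX hXY (y α v ρ) = Y :=
  (RingQuot.liftAlgHom_mkAlgHom_apply K _ _ _).trans (FreeAlgebra.lift_ι_apply _ _)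

theorem lift_ofCoeff (a : A) : lift f X Y hY hX hXY (ofCoeff α v ρ a) = f a :=
  (RingQuot.liftAlgHom_mkAlgHom_apply K _ _ _).trans (FreeAlgebra.lift_ι_apply _ _)

end

/-- The ambiskew polynomial algebra is left Noetherian over a Noetherian base. -/
theorem isNoetherianRing [IsNoetherianRing A] : IsNoetherianRing (AmbiskewAlgebra α v ρ) := by
  let S₀ : Subring (AmbiskewAlgebra α v ρ) := (ofCoeff α v ρ : A →+* AmbiskewAlgebra α v ρ).range
  have : IsNoetherianRing S₀ := isNoetherianRing_range _
  -- The Hilbert theorem is applied twice: adjoining `y` to the image of `A` gives `S`, and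
  -- adjoining `x` to `S` gives everything. `T₀` is the image of `A` viewed inside the ring `S`.
  let S : Subring (AmbiskewAlgebra α v ρ) := Subring.closure (insert (y α v ρ) S₀)
  have hS₀ : ∀ a, ofCoeff α v ρ a ∈ S := fun a => Subring.subset_closure (Or.inr ⟨a, rfl⟩)
  have hyS : y α v ρ ∈ S := Subring.subset_closure (Or.inl rfl)
  let T₀ : Subring S := S₀.comap S.subtype
  have hS₀S : S₀ ≤ S := by
    rintro _ ⟨a, rfl⟩
    exact hS₀ a
  let e : S₀ →+* T₀ :=
    { toFun := fun a => ⟨⟨a, hS₀S a.2⟩, a.2⟩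
      map_one' := rfl
      map_mul' := fun _ _ => rfl
      map_zero' := rfl
      map_add' := fun _ _ => rfl }
  have : IsNoetherianRing T₀ := isNoetherianRing_of_surjective S₀ T₀ e
    fun a => ⟨⟨a, a.2⟩, rfl⟩
  have hSN : IsNoetherianRing S := by
    refine SkewHilbert.isNoetherianRing (S := T₀) (t := ⟨y α v ρ, hyS⟩) ?_ ?_ ?_
    · rintro ⟨_, hs⟩ ⟨a, rfl⟩
      refine ⟨⟨ofCoeff α v ρ (α.symm a), hS₀ _⟩, ⟨_, rfl⟩, 0, zero_mem _, Subtype.ext ?_⟩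
      change ofCoeff α v ρ a * y α v ρ = y α v ρ * ofCoeff α v ρ (α.symm a) + 0
      rw [y_mul_ofCoeff, AlgEquiv.apply_symm_apply, add_zero]
    · rintro ⟨_, hs⟩ ⟨a, rfl⟩
      refine ⟨⟨ofCoeff α v ρ (α a), hS₀ _⟩, ⟨_, rfl⟩, 0, zero_mem _, Subtype.ext ?_⟩
      change y α v ρ * ofCoeff α v ρ a = ofCoeff α v ρ (α a) * y α v ρ + 0
      rw [y_mul_ofCoeff, add_zero]
    · have hle : S ≤ (Subring.closure (insert ⟨y α v ρ, hyS⟩ (T₀ : Set S))).map S.subtype := by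
        refine Subring.closure_le.2 ?_
        rintro r (rfl | hr)
        · exact ⟨_, Subring.subset_closure (Or.inl rfl), rfl⟩
        · exact ⟨⟨r, hS₀S hr⟩, Subring.subset_closure (Or.inr hr), rfl⟩
      refine (Subring.eq_top_iff' _).2 fun r => ?_
      obtain ⟨r', hr', he⟩ := hle r.2
      rwa [← Subtype.ext he]
  have hsmul : ∀ (r : K) s, s ∈ S → r • s ∈ S := fun r s hs => by
    rw [Algebra.smul_def, ← (ofCoeff α v ρ).commutes]
    exact mul_mem (hS₀ _) hs
  refine SkewHilbert.isNoetherianRing (S := S) (t := x α v ρ) ?_ ?_ ?_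
  -- The elements of `S` with this exchange property form a subring, so generators suffice. For `y`
  -- the last relation is solved for `y x`, which uses that `ρ` is invertible.
  · intro s hs
    induction hs using Subring.closure_induction with
    | mem s hs =>
      rcases hs with rfl | ⟨a, rfl⟩
      · refine ⟨((ρ⁻¹ : Kˣ) : K) • y α v ρ, hsmul _ _ hyS,
          -(((ρ⁻¹ : Kˣ) : K) • ofCoeff α v ρ v), neg_mem (hsmul _ _ (hS₀ _)), ?_⟩
        rw [mul_smul_comm, x_mul_y, smul_add, smul_smul, Units.inv_mul, one_smul]
        abel
      · refine ⟨_, hS₀ (α a), 0, zero_mem _, ?_⟩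
        rw [x_mul_ofCoeff, AlgEquiv.symm_apply_apply, add_zero]
        rfl
    | zero => exact ⟨0, zero_mem _, 0, zero_mem _, by simp⟩
    | one => exact ⟨1, one_mem _, 0, zero_mem _, by simp⟩
    | add a b _ _ iha ihb =>
      obtain ⟨a', ha', a'', ha'', ha⟩ := iha
      obtain ⟨b', hb', b'', hb'', hb⟩ := ihb
      exact ⟨a' + b', add_mem ha' hb', a'' + b'', add_mem ha'' hb'', by
        rw [add_mul, ha, hb, mul_add]; abel⟩
    | neg a _ iha =>
      obtain ⟨a', ha', a'', ha'', ha⟩ := iha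
      exact ⟨-a', neg_mem ha', -a'', neg_mem ha'', by rw [neg_mul, ha, mul_neg]; abel⟩
    | mul a b ha₀ hb₀ iha ihb =>
      obtain ⟨a', ha', a'', ha'', ha⟩ := iha
      obtain ⟨b', hb', b'', hb'', hb⟩ := ihb
      refine ⟨a' * b', mul_mem ha' hb', a'' * b' + a * b'',
        add_mem (mul_mem ha'' hb') (mul_mem ha₀ hb''), ?_⟩
      rw [mul_assoc, hb, mul_add, ← mul_assoc, ha]
      noncomm_ring
  · intro s hs
    induction hs using Subring.closure_induction with
    | mem s hs =>
      rcases hs with rfl | ⟨a, rfl⟩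
      · refine ⟨(ρ : K) • y α v ρ, hsmul _ _ hyS, ofCoeff α v ρ v, hS₀ _, ?_⟩
        rw [smul_mul_assoc, x_mul_y]
      · refine ⟨_, hS₀ (α.symm a), 0, zero_mem _, ?_⟩
        rw [add_zero]
        exact x_mul_ofCoeff _ _ _ _
    | zero => exact ⟨0, zero_mem _, 0, zero_mem _, by simp⟩
    | one => exact ⟨1, one_mem _, 0, zero_mem _, by simp⟩
    | add a b _ _ iha ihb =>
      obtain ⟨a', ha', a'', ha'', ha⟩ := iha
      obtain ⟨b', hb', b'', hb'', hb⟩ := ihb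
      exact ⟨a' + b', add_mem ha' hb', a'' + b'', add_mem ha'' hb'', by
        rw [mul_add, ha, hb, add_mul]; abel⟩
    | neg a _ iha =>
      obtain ⟨a', ha', a'', ha'', ha⟩ := iha
      exact ⟨-a', neg_mem ha', -a'', neg_mem ha'', by rw [mul_neg, ha, neg_mul]; abel⟩
    | mul a b ha₀ hb₀ iha ihb =>
      obtain ⟨a', ha', a'', ha'', ha⟩ := iha
      obtain ⟨b', hb', b'', hb'', hb⟩ := ihb
      refine ⟨a' * b', mul_mem ha' hb', a' * b'' + a'' * b,
        add_mem (mul_mem ha' hb'') (mul_mem ha'' hb₀), ?_⟩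
      rw [← mul_assoc, ha, add_mul, mul_assoc, hb]
      noncomm_ring
  · rw [eq_top_iff, ← closure_generators]
    refine Subring.closure_mono ?_
    rintro _ ((rfl | rfl) | ⟨a, rfl⟩)
    · exact Or.inl rfl
    · exact Or.inr hyS
    · exact Or.inr (hS₀ a)

/-- The anti-automorphism exchanging `x` and `y`. -/
def flip : AmbiskewAlgebra α v ρ →ₐ[K] (AmbiskewAlgebra α v ρ)ᵐᵒᵖ :=
  lift
    ((AlgHom.op (ofCoeff α v ρ)).comp (AlgEquiv.toOpposite K A).toAlgHom)
    (MulOpposite.op (y α v ρ)) (MulOpposite.op (x α v ρ))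
    (fun a => by
      change MulOpposite.op (x α v ρ) * MulOpposite.op (ofCoeff α v ρ a) =
        MulOpposite.op (ofCoeff α v ρ (α a)) * MulOpposite.op (x α v ρ)
      rw [← MulOpposite.op_mul, ← MulOpposite.op_mul, x_mul_ofCoeff, AlgEquiv.symm_apply_apply])
    (fun a => by
      change MulOpposite.op (y α v ρ) * MulOpposite.op (ofCoeff α v ρ a) =
        MulOpposite.op (ofCoeff α v ρ (α.symm a)) * MulOpposite.op (y α v ρ)
      rw [← MulOpposite.op_mul, ← MulOpposite.op_mul, y_mul_ofCoeff, AlgEquiv.apply_symm_apply])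
    (by
      change MulOpposite.op (y α v ρ) * MulOpposite.op (x α v ρ) =
        (ρ : K) • (MulOpposite.op (x α v ρ) * MulOpposite.op (y α v ρ)) +
          MulOpposite.op (ofCoeff α v ρ v)
      rw [← MulOpposite.op_mul, ← MulOpposite.op_mul, x_mul_y, MulOpposite.op_add,
        MulOpposite.op_smul])

theorem flip_surjective : Function.Surjective (flip α v ρ) := by
  have h : ∀ r, MulOpposite.op r ∈ (flip α v ρ).range := by
    intro r
    have hr : r ∈ Subring.closure (generators α v ρ) := by rw [closure_generators]; trivial
    induction hr using Subring.closure_induction with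
    | mem r hr =>
      rcases hr with (rfl | rfl) | ⟨a, rfl⟩
      · exact ⟨y α v ρ, lift_y _ _ _ _ _ _⟩
      · exact ⟨x α v ρ, lift_x _ _ _ _ _ _⟩
      · exact ⟨ofCoeff α v ρ a, lift_ofCoeff _ _ _ _ _ _ _⟩
    | zero => exact zero_mem _
    | one => exact one_mem _
    | add a b _ _ ha hb => exact add_mem ha hb
    | neg a _ ha => exact neg_mem ha
    | mul a b _ _ ha hb => exact mul_mem hb ha
  intro r
  exact h r.unop

/-- Reversing products while exchanging `x` and `y` fixes `x y` and `y x` and swaps the two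
relations with `A`, so the opposite ring is an image of the ring itself. -/
theorem isNoetherianRing_op [IsNoetherianRing A] : IsNoetherianRing (AmbiskewAlgebra α v ρ)ᵐᵒᵖ :=
  have := isNoetherianRing α v ρ
  isNoetherianRing_of_surjective _ _ (flip α v ρ).toRingHom
    (flip_surjective α v ρ)

end AmbiskewAlgebra

/-! ### The skew Laurent model of an augmented down-up algebra -/

namespace AugmentedDownUpAlgebra

open LaurentPolynomial AugmentedDownUp

variable {K : Type*} [Field K]

section Model

variable {L : Type*} [CommRing L] [Algebra K L]

/-- Linearity of the action over `K` makes the skew Laurent ring a `K`-algebra. -/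
instance (p : Kˣ) : SMulCommClass (ScaleGroup p) K L[T;T⁻¹] where
  smul_comm i r g := by
    obtain ⟨m, hm⟩ := ScaleGroup.exists_of i
    apply LaurentPolynomial.ext
    intro j
    rw [hm, ScaleGroup.coeff_smul, AddMonoidAlgebra.coeff_smul,
      AddMonoidAlgebra.coeff_smul, Finsupp.smul_apply, Finsupp.smul_apply, ScaleGroup.coeff_smul,
      mul_smul_comm]

/-- The homomorphism `K[c, k, k⁻¹] → L[k, k⁻¹]` sending `c` to a given element of `L`. -/
noncomputable def coeffHom (c' : L) : K[T;T⁻¹][X] →ₐ[K] L[T;T⁻¹] :=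
  { Polynomial.eval₂RingHom (AddMonoidAlgebra.mapRingHom ℤ (algebraMap K L))
      (LaurentPolynomial.C c') with
    commutes' := fun r => by
      change Polynomial.eval₂ _ _ (Polynomial.C (LaurentPolynomial.C r)) = _
      rw [Polynomial.eval₂_C, ← single_eq_C, AddMonoidAlgebra.mapRingHom_single]
      rfl }

theorem coeffHom_X (c' : L) :
    coeffHom (K := K) c' Polynomial.X = LaurentPolynomial.C c' := Polynomial.eval₂_X _ _

theorem coeffHom_C (c' : L) (g : K[T;T⁻¹]) :
    coeffHom c' (Polynomial.C g) = AddMonoidAlgebra.mapRingHom ℤ (algebraMap K L) g :=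
  Polynomial.eval₂_C _ _

theorem mapRingHom_T {L' : Type*} [CommRing L'] (φ : L' →+* L) (i : ℤ) :
    AddMonoidAlgebra.mapRingHom ℤ φ (T i) = T i :=
  (AddMonoidAlgebra.mapRingHom_single _ _ _).trans (congrArg _ (map_one φ))

theorem mapRingHom_C {L' : Type*} [CommRing L'] (φ : L' →+* L) (s : L') :
    AddMonoidAlgebra.mapRingHom ℤ φ (LaurentPolynomial.C s) = LaurentPolynomial.C (φ s) :=
  AddMonoidAlgebra.mapRingHom_single _ _ _

/-- `α` becomes the action of the generator of the group, so conjugation by `y` in the model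
realises it. -/
theorem coeffHom_alpha (q : Kˣ) (c' : L) (a : K[T;T⁻¹][X]) :
    coeffHom c' (alpha q a) = ScaleGroup.of (q ^ 2) 1 • coeffHom c' a := by
  have hC : ∀ g : K[T;T⁻¹], coeffHom c' (alpha q (Polynomial.C g)) =
      ScaleGroup.of (q ^ 2) 1 • coeffHom c' (Polynomial.C g) := fun g => by
    rw [show alpha q (Polynomial.C g) = Polynomial.C (rescale (q ^ 2) g) from Polynomial.map_C _,
      coeffHom_C, coeffHom_C, algebraMap_map_rescale, ScaleGroup.smul_def, zpow_one]
  have hX : coeffHom c' (alpha q Polynomial.X) =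
      ScaleGroup.of (q ^ 2) 1 • coeffHom (K := K) c' Polynomial.X := by
    rw [show alpha q Polynomial.X = Polynomial.X from Polynomial.map_X _, coeffHom_X,
      ScaleGroup.smul_C]
  induction a using Polynomial.induction_on' with
  | add a b ha hb => rw [map_add, map_add, map_add, ha, hb, smul_add]
  | monomial m g =>
    rw [← Polynomial.C_mul_X_pow_eq_monomial, map_mul, map_mul, map_mul, smul_mul', hC, map_pow,
      map_pow, map_pow, smul_pow', hX]

theorem coeffHom_alpha_symm (q : Kˣ) (c' : L) (a : K[T;T⁻¹][X]) :
    coeffHom c' ((alpha q).symm a) = ScaleGroup.of (q ^ 2) (-1) • coeffHom c' a := by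
  conv_rhs => rw [← (alpha q).apply_symm_apply a, coeffHom_alpha, smul_smul, ← ScaleGroup.of_add]
  exact (one_smul _ _).symm

variable (q : Kˣ) (n : ℤ) (f : K[T;T⁻¹]) (c' z' : L)

/-- The Laurent polynomial `z + c kⁿ + f(k)`, the value of `x y`. -/
noncomputable def weight : L[T;T⁻¹] := LaurentPolynomial.C z' + coeffHom c' (u n f)

theorem weight_eq : weight n f c' z' = LaurentPolynomial.C z' + (LaurentPolynomial.C c' * T n +
    AddMonoidAlgebra.mapRingHom ℤ (algebraMap K L) f) := by
  rw [weight, u, map_add, map_mul, coeffHom_X, coeffHom_C, coeffHom_C, mapRingHom_T]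

/-- Since `a_n = 0` and `n ≠ 0`, the coefficients of `kⁿ` and `k⁰` are exactly `c'` and `z' + a₀`.
-/
theorem weight_ne_zero (hn : n ≠ 0) (hf : f.coeff n = 0)
    (h : c' ≠ 0 ∨ z' + algebraMap K L (f.coeff 0) ≠ 0) : weight n f c' z' ≠ 0 := by
  intro h0
  have hw : ∀ j, (weight n f c' z').coeff j = (if 0 = j then z' else 0) +
      ((if n = j then c' else 0) + algebraMap K L (f.coeff j)) := fun j => by
    rw [weight_eq, AddMonoidAlgebra.coeff_add, AddMonoidAlgebra.coeff_add, Finsupp.add_apply,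
      Finsupp.add_apply, coeff_C_mul_T, AddMonoidAlgebra.coeff_mapRingHom, C_apply]
    simp only [eq_comm]
  have h1 := hw n
  have h2 := hw 0
  rw [h0, AddMonoidAlgebra.coeff_zero, Finsupp.zero_apply] at h1 h2
  simp only [hn, hn.symm, hf, if_true, if_false, map_zero, add_zero, zero_add] at h1 h2
  rcases h with h | h
  · exact h h1.symm
  · exact h h2.symm

/-- The homomorphism from `K[c, k, k⁻¹]` to the skew Laurent polynomial ring. -/
noncomputable def coeffToSkewLaurent :
    K[T;T⁻¹][X] →ₐ[K] SkewMonoidAlgebra L[T;T⁻¹] (ScaleGroup (q ^ 2)) :=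
  AlgHom.mk ((SkewMonoidAlgebra.singleOneRingHom : L[T;T⁻¹] →+* SkewMonoidAlgebra L[T;T⁻¹]
        (ScaleGroup (q ^ 2))).comp (coeffHom c').toRingHom)
    fun r => congrArg (SkewMonoidAlgebra.single 1) ((coeffHom c').commutes r)

/-- The homomorphism from the augmented down-up algebra to the skew Laurent polynomial ring over
`L[k, k⁻¹]` sending `c` and `z` to given elements of `L`. -/
noncomputable def toSkewLaurent :
    AugmentedDownUpAlgebra q n f →ₐ[K] SkewMonoidAlgebra L[T;T⁻¹] (ScaleGroup (q ^ 2)) :=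
  AmbiskewAlgebra.lift
    (coeffToSkewLaurent q c')
    (.single (ScaleGroup.of _ (-1)) (weight n f c' z'))
    (.single (ScaleGroup.of _ 1) 1)
    (fun a => by
      change SkewMonoidAlgebra.single _ _ * SkewMonoidAlgebra.single 1 (coeffHom c' a) =
        SkewMonoidAlgebra.single 1 (coeffHom c' (alpha q a)) * SkewMonoidAlgebra.single _ _
      rw [SkewMonoidAlgebra.single_mul_single, SkewMonoidAlgebra.single_mul_single, coeffHom_alpha,
        one_mul, mul_one, one_mul, one_smul, mul_one])
    (fun a => by
      change SkewMonoidAlgebra.single _ _ * SkewMonoidAlgebra.single 1 (coeffHom c' a) =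
        SkewMonoidAlgebra.single 1 (coeffHom c' ((alpha q).symm a)) * SkewMonoidAlgebra.single _ _
      rw [SkewMonoidAlgebra.single_mul_single, SkewMonoidAlgebra.single_mul_single,
        coeffHom_alpha_symm, one_mul, mul_one, one_smul, mul_comm])
    (by
      -- In the model `x y = w` and `y x = α(w)`; the constant `z'` cancels in `w - α(w)`, leaving
      -- `u - α(u)`.
      change SkewMonoidAlgebra.single _ _ * SkewMonoidAlgebra.single _ _ =
        ((1 : Kˣ) : K) • (SkewMonoidAlgebra.single _ _ * SkewMonoidAlgebra.single _ _) +
          SkewMonoidAlgebra.single 1 (coeffHom c' (u n f - alpha q (u n f)))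
      rw [SkewMonoidAlgebra.single_mul_single, SkewMonoidAlgebra.single_mul_single, Units.val_one,
        one_smul, smul_one, mul_one, one_mul, ← ScaleGroup.of_add, ← ScaleGroup.of_add,
        neg_add_cancel, add_neg_cancel, ScaleGroup.of_zero, ← SkewMonoidAlgebra.single_add, map_sub,
        coeffHom_alpha, weight, smul_add, ScaleGroup.smul_C]
      congr 1
      ring)

theorem toSkewLaurent_x : toSkewLaurent q n f c' z' (AmbiskewAlgebra.x _ _ _) =
    .single (ScaleGroup.of _ (-1)) (weight n f c' z') := AmbiskewAlgebra.lift_x _ _ _ _ _ _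

theorem toSkewLaurent_y : toSkewLaurent q n f c' z' (AmbiskewAlgebra.y _ _ _) =
    .single (ScaleGroup.of _ 1) 1 := AmbiskewAlgebra.lift_y _ _ _ _ _ _

theorem toSkewLaurent_ofCoeff (a : K[T;T⁻¹][X]) :
    toSkewLaurent q n f c' z' (AmbiskewAlgebra.ofCoeff _ _ _ a) = .single 1 (coeffHom c' a) :=
  AmbiskewAlgebra.lift_ofCoeff _ _ _ _ _ _ _

theorem toSkewLaurent_c :
    toSkewLaurent q n f c' z' (c q n f) = .single 1 (LaurentPolynomial.C c') := by
  rw [c, toSkewLaurent_ofCoeff, coeffHom_X]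

theorem toSkewLaurent_z :
    toSkewLaurent q n f c' z' (z q n f) = .single 1 (LaurentPolynomial.C z') := by
  rw [z, map_sub, map_mul, toSkewLaurent_x, toSkewLaurent_y, toSkewLaurent_ofCoeff,
    SkewMonoidAlgebra.single_mul_single, smul_one, mul_one, ← ScaleGroup.of_add, neg_add_cancel,
    ScaleGroup.of_zero, sub_eq_iff_eq_add, ← SkewMonoidAlgebra.single_add, weight]

end Model

/-! ### Central elements and the normal form -/

section NormalForm

variable (q : Kˣ) (n : ℤ) (f : K[T;T⁻¹])

local notation "𝓡" => AugmentedDownUpAlgebra q n f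
local notation "𝓒" => MvPolynomial (Fin 2) K

/-- The element `x`. -/
noncomputable abbrev x : 𝓡 := AmbiskewAlgebra.x _ _ _

/-- The element `y`. -/
noncomputable abbrev y : 𝓡 := AmbiskewAlgebra.y _ _ _

/-- The structure map from `K[c, k, k⁻¹]`. -/
noncomputable abbrev ofCoeff : K[T;T⁻¹][X] →ₐ[K] 𝓡 := AmbiskewAlgebra.ofCoeff _ _ _

theorem y_mul_ofCoeff (a : K[T;T⁻¹][X]) :
    y q n f * ofCoeff q n f a = ofCoeff q n f (alpha q a) * y q n f :=
  AmbiskewAlgebra.y_mul_ofCoeff _ _ _ _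

theorem x_mul_ofCoeff (a : K[T;T⁻¹][X]) :
    x q n f * ofCoeff q n f a = ofCoeff q n f ((alpha q).symm a) * x q n f :=
  AmbiskewAlgebra.x_mul_ofCoeff _ _ _ _

theorem x_mul_y : x q n f * y q n f = z q n f + ofCoeff q n f (u n f) := by
  rw [z, sub_add_cancel]

theorem y_mul_x : y q n f * x q n f = z q n f + ofCoeff q n f (alpha q (u n f)) := by
  have h : x q n f * y q n f = ((1 : Kˣ) : K) • (y q n f * x q n f) +
    ofCoeff q n f (u n f - alpha q (u n f)) := AmbiskewAlgebra.x_mul_y _ _ _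
  rw [x_mul_y, Units.val_one, one_smul, map_sub] at h
  rw [← sub_eq_iff_eq_add, ← sub_eq_zero]
  rw [← sub_eq_zero] at h
  rw [← neg_eq_zero, ← h]
  abel

theorem mem_center_of_commute {r : 𝓡} (hx : x q n f * r = r * x q n f)
    (hy : y q n f * r = r * y q n f) (ha : ∀ a, ofCoeff q n f a * r = r * ofCoeff q n f a) :
    r ∈ Subalgebra.center K 𝓡 := by
  rw [Subalgebra.mem_center_iff]
  intro b
  have hb : b ∈ Subring.closure (AmbiskewAlgebra.generators (alpha q) (u n f - alpha q (u n f)) 1) :=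
    by rw [AmbiskewAlgebra.closure_generators]; trivial
  induction hb using Subring.closure_induction with
  | mem b hb =>
    rcases hb with (rfl | rfl) | ⟨a, rfl⟩
    · exact hx
    · exact hy
    · exact ha a
  | zero => rw [zero_mul, mul_zero]
  | one => rw [one_mul, mul_one]
  | add a b _ _ iha ihb => rw [add_mul, mul_add, iha, ihb]
  | neg a _ iha => rw [neg_mul, mul_neg, iha]
  | mul a b _ _ iha ihb => rw [mul_assoc, ihb, ← mul_assoc, iha, mul_assoc]

theorem ofCoeff_comm (a b : K[T;T⁻¹][X]) :
    ofCoeff q n f a * ofCoeff q n f b = ofCoeff q n f b * ofCoeff q n f a := by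
  rw [← map_mul, mul_comm, map_mul]

theorem c_mem_center : c q n f ∈ Subalgebra.center K 𝓡 := by
  have h : alpha q Polynomial.X = Polynomial.X := Polynomial.map_X _
  refine mem_center_of_commute q n f ?_ ?_ fun a => ofCoeff_comm q n f _ _
  · change x q n f * ofCoeff q n f Polynomial.X = ofCoeff q n f Polynomial.X * x q n f
    rw [x_mul_ofCoeff, (AlgEquiv.symm_apply_eq _).2 h.symm]
  · change y q n f * ofCoeff q n f Polynomial.X = ofCoeff q n f Polynomial.X * y q n f
    rw [y_mul_ofCoeff, h]

theorem z_eq_y_mul_x_sub : z q n f = y q n f * x q n f - ofCoeff q n f (alpha q (u n f)) := by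
  rw [y_mul_x, add_sub_cancel_right]

theorem z_eq_x_mul_y_sub : z q n f = x q n f * y q n f - ofCoeff q n f (u n f) := rfl

/-- From `z = x y - u = y x - α(u)` one gets `x (y x - α(u)) = (x y - u) x`, and similarly for `y`.
On coefficients the twists by `x` and `y` cancel. -/
theorem z_mem_center : z q n f ∈ Subalgebra.center K 𝓡 := by
  refine mem_center_of_commute q n f ?_ ?_ fun a => ?_
  · conv_lhs => rw [z_eq_y_mul_x_sub, mul_sub, x_mul_ofCoeff, AlgEquiv.symm_apply_apply]
    rw [z_eq_x_mul_y_sub, sub_mul, mul_assoc]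
  · conv_lhs => rw [z_eq_x_mul_y_sub, mul_sub, y_mul_ofCoeff]
    rw [z_eq_y_mul_x_sub, sub_mul, mul_assoc]
  · rw [z_eq_x_mul_y_sub, mul_sub, sub_mul, ofCoeff_comm q n f a, mul_assoc (x q n f),
      y_mul_ofCoeff, ← mul_assoc (x q n f), x_mul_ofCoeff, AlgEquiv.symm_apply_apply, mul_assoc]

/-- The homomorphism from the polynomial algebra `K[c, z]` to the centre. -/
noncomputable def centerHom : 𝓒 →ₐ[K] Subalgebra.center K 𝓡 :=
  MvPolynomial.aeval ![⟨c q n f, c_mem_center q n f⟩, ⟨z q n f, z_mem_center q n f⟩]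

theorem centerHom_X_zero : (centerHom q n f (MvPolynomial.X 0) : 𝓡) = c q n f := by
  rw [centerHom, MvPolynomial.aeval_X]; rfl

theorem centerHom_X_one : (centerHom q n f (MvPolynomial.X 1) : 𝓡) = z q n f := by
  rw [centerHom, MvPolynomial.aeval_X]; rfl

theorem commute_centerHom (P : 𝓒) (r : 𝓡) : Commute (centerHom q n f P : 𝓡) r :=
  (Subalgebra.mem_center_iff.1 (centerHom q n f P).2 r).symm

/-- The homomorphism from `K[c, z][k, k⁻¹]`. -/
noncomputable def baseHom : 𝓒[T;T⁻¹] →+* 𝓡 :=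
  AddMonoidAlgebra.liftNCRingHom
    ((Subalgebra.center K 𝓡).val.toRingHom.comp (centerHom q n f).toRingHom)
    { toFun := fun i => ofCoeff q n f (Polynomial.C (T i.toAdd))
      map_one' := by rw [toAdd_one, T_zero, map_one, map_one]
      map_mul' := fun i j => by rw [toAdd_mul, T_add, map_mul, map_mul] }
    fun P _ => commute_centerHom q n f P _

theorem baseHom_C_mul_T (P : 𝓒) (i : ℤ) : baseHom q n f (LaurentPolynomial.C P * T i) =
    centerHom q n f P * ofCoeff q n f (Polynomial.C (T i)) := by
  rw [← single_eq_C_mul_T]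
  exact AddMonoidAlgebra.liftNCRingHom_single _ _ _ _ _

theorem baseHom_C (P : 𝓒) : baseHom q n f (LaurentPolynomial.C P) = centerHom q n f P := by
  have := baseHom_C_mul_T q n f P 0
  rwa [T_zero, mul_one, T_zero, map_one, map_one, mul_one] at this

theorem baseHom_coeffHom (a : K[T;T⁻¹][X]) :
    baseHom q n f (coeffHom (MvPolynomial.X 0) a) = ofCoeff q n f a := by
  have hC : ∀ g : K[T;T⁻¹], baseHom q n f (coeffHom (MvPolynomial.X 0) (Polynomial.C g)) =
      ofCoeff q n f (Polynomial.C g) := fun g => by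
    rw [coeffHom_C]
    induction g using LaurentPolynomial.induction_on' with
    | add a b ha hb => rw [map_add, map_add, map_add, map_add, ha, hb]
    | C_mul_T i s =>
      rw [map_mul, mapRingHom_C, mapRingHom_T, baseHom_C_mul_T, map_mul, map_mul]
      congr 1
      rw [AlgHom.commutes]
      exact ((ofCoeff q n f).commutes s).symm
  induction a using Polynomial.induction_on' with
  | add a b ha hb => rw [map_add, map_add, map_add, ha, hb]
  | monomial m g =>
    rw [← Polynomial.C_mul_X_pow_eq_monomial, map_mul, map_mul, map_mul, hC, map_pow, map_pow,
      map_pow, coeffHom_X, baseHom_C, centerHom_X_zero]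
    rfl

theorem baseHom_weight : baseHom q n f (weight n f (MvPolynomial.X 0) (MvPolynomial.X 1)) =
    x q n f * y q n f := by
  rw [weight, map_add, baseHom_C, centerHom_X_one, baseHom_coeffHom, x_mul_y]

/-- With `baseHom_weight`, this places `x y` and `y x` in the commutative base ring, one translate
apart. -/
theorem baseHom_smul_weight : baseHom q n f (ScaleGroup.of (q ^ 2) 1 •
    weight n f (MvPolynomial.X 0) (MvPolynomial.X 1)) = y q n f * x q n f := by
  rw [weight, smul_add, ScaleGroup.smul_C, map_add, baseHom_C, centerHom_X_one, ← coeffHom_alpha,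
    baseHom_coeffHom, y_mul_x]

theorem y_mul_baseHom (d : 𝓒[T;T⁻¹]) : y q n f * baseHom q n f d =
    baseHom q n f (ScaleGroup.of (q ^ 2) 1 • d) * y q n f := by
  induction d using LaurentPolynomial.induction_on' with
  | add a b ha hb => rw [map_add, mul_add, ha, hb, smul_add, map_add, add_mul]
  | C_mul_T i P =>
    have hT : (T i : 𝓒[T;T⁻¹]) = coeffHom (MvPolynomial.X 0) (Polynomial.C (T i : K[T;T⁻¹])) := by
      rw [coeffHom_C, mapRingHom_T]
    rw [smul_mul', ScaleGroup.smul_C, map_mul, map_mul, baseHom_C, ← mul_assoc,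
      ← (commute_centerHom q n f P (y q n f)).eq, mul_assoc, mul_assoc, hT, ← coeffHom_alpha,
      baseHom_coeffHom, baseHom_coeffHom, y_mul_ofCoeff]

theorem x_mul_baseHom (d : 𝓒[T;T⁻¹]) : x q n f * baseHom q n f d =
    baseHom q n f (ScaleGroup.of (q ^ 2) (-1) • d) * x q n f := by
  induction d using LaurentPolynomial.induction_on' with
  | add a b ha hb => rw [map_add, mul_add, ha, hb, smul_add, map_add, add_mul]
  | C_mul_T i P =>
    have hT : (T i : 𝓒[T;T⁻¹]) = coeffHom (MvPolynomial.X 0) (Polynomial.C (T i : K[T;T⁻¹])) := by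
      rw [coeffHom_C, mapRingHom_T]
    rw [smul_mul', ScaleGroup.smul_C, map_mul, map_mul, baseHom_C, ← mul_assoc,
      ← (commute_centerHom q n f P (x q n f)).eq, mul_assoc, mul_assoc, hT, ← coeffHom_alpha_symm,
      baseHom_coeffHom, baseHom_coeffHom, x_mul_ofCoeff]

/-- The homogeneous element `yⁱ` for `i ≥ 0` and `x⁻ⁱ` for `i ≤ 0`. -/
noncomputable def basisElt (i : ℤ) : 𝓡 := y q n f ^ i.toNat * x q n f ^ (-i).toNat

theorem basisElt_natCast (m : ℕ) : basisElt q n f m = y q n f ^ m := by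
  simp [basisElt]

theorem basisElt_neg_natCast (m : ℕ) : basisElt q n f (-m) = x q n f ^ m := by
  simp [basisElt]

/-- The additive homomorphism `(dᵢ) ↦ ∑ dᵢ bᵢ`. -/
noncomputable def normalForm : (ℤ →₀ 𝓒[T;T⁻¹]) →+ 𝓡 :=
  Finsupp.liftAddHom fun i =>
    (AddMonoidHom.mulRight (basisElt q n f i)).comp (baseHom q n f).toAddMonoidHom

theorem normalForm_apply (g : ℤ →₀ 𝓒[T;T⁻¹]) :
    normalForm q n f g = g.sum fun i d => baseHom q n f d * basisElt q n f i := rfl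

theorem normalForm_single (i : ℤ) (d : 𝓒[T;T⁻¹]) :
    normalForm q n f (.single i d) = baseHom q n f d * basisElt q n f i :=
  Finsupp.liftAddHom_apply_single _ _ _

/-- The range of `normalForm`. -/
noncomputable def normalRange : AddSubmonoid 𝓡 where
  carrier := Set.range (normalForm q n f)
  add_mem' := by
    rintro _ _ ⟨g, rfl⟩ ⟨h, rfl⟩
    exact ⟨g + h, map_add _ _ _⟩
  zero_mem' := ⟨0, map_zero _⟩

theorem baseHom_mul_mem_range (d : 𝓒[T;T⁻¹]) (i : ℤ) :
    baseHom q n f d * basisElt q n f i ∈ normalRange q n f :=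
  ⟨_, normalForm_single q n f i d⟩

theorem y_mul_mem_range (d : 𝓒[T;T⁻¹]) (i : ℤ) :
    y q n f * (baseHom q n f d * basisElt q n f i) ∈ normalRange q n f := by
  rw [← mul_assoc, y_mul_baseHom, mul_assoc]
  obtain ⟨m, rfl | rfl⟩ := i.eq_nat_or_neg
  · rw [basisElt_natCast, ← pow_succ', ← basisElt_natCast]
    exact baseHom_mul_mem_range q n f _ _
  · cases m with
    | zero =>
      have h := basisElt_natCast q n f 1
      rw [Nat.cast_zero, neg_zero, show basisElt q n f 0 = 1 by simp [basisElt], mul_one,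
        ← pow_one (y q n f), ← h]
      exact baseHom_mul_mem_range q n f _ _
    | succ m =>
      rw [basisElt_neg_natCast, pow_succ' (x q n f), ← mul_assoc (y q n f), ← baseHom_smul_weight, ← mul_assoc,
        ← map_mul, ← basisElt_neg_natCast]
      exact baseHom_mul_mem_range q n f _ _

theorem x_mul_mem_range (d : 𝓒[T;T⁻¹]) (i : ℤ) :
    x q n f * (baseHom q n f d * basisElt q n f i) ∈ normalRange q n f := by
  rw [← mul_assoc, x_mul_baseHom, mul_assoc]
  obtain ⟨m, rfl | rfl⟩ := i.eq_nat_or_neg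
  · cases m with
    | zero =>
      have h := basisElt_neg_natCast q n f 1
      rw [Nat.cast_zero, show basisElt q n f 0 = 1 by simp [basisElt], mul_one,
        ← pow_one (x q n f), ← h]
      exact baseHom_mul_mem_range q n f _ _
    | succ m =>
      rw [basisElt_natCast, pow_succ' (y q n f), ← mul_assoc (x q n f), ← baseHom_weight, ← mul_assoc,
        ← map_mul, ← basisElt_natCast]
      exact baseHom_mul_mem_range q n f _ _
  · rw [basisElt_neg_natCast, ← pow_succ', ← basisElt_neg_natCast]
    exact baseHom_mul_mem_range q n f _ _

/-- The range contains `1` and is stable under left multiplication by the generators: coefficients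
move past `x` and `y` by a twist, and an adjacent pair `x y` or `y x` is absorbed into the
coefficient. -/
theorem normalForm_surjective : Function.Surjective (normalForm q n f) := by
  have hmul : ∀ b : 𝓡, (∀ d i, b * (baseHom q n f d * basisElt q n f i) ∈ normalRange q n f) →
      ∀ r ∈ normalRange q n f, b * r ∈ normalRange q n f := by
    rintro b hb _ ⟨g, rfl⟩
    rw [normalForm_apply, Finsupp.mul_sum]
    exact sum_mem fun i _ => hb _ _
  have key : ∀ b ∈ Subring.closure
      (AmbiskewAlgebra.generators (alpha q) (u n f - alpha q (u n f)) 1),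
      ∀ r ∈ normalRange q n f, b * r ∈ normalRange q n f := by
    intro b hb
    induction hb using Subring.closure_induction with
    | mem b hb =>
      rcases hb with (rfl | rfl) | ⟨a, rfl⟩
      · exact hmul _ (x_mul_mem_range q n f)
      · exact hmul _ (y_mul_mem_range q n f)
      · refine hmul _ fun d i => ?_
        rw [← baseHom_coeffHom, ← mul_assoc, ← map_mul]
        exact baseHom_mul_mem_range q n f _ _
    | zero => intro r _; rw [zero_mul]; exact zero_mem _
    | one => intro r hr; rwa [one_mul]
    | add a b _ _ iha ihb => intro r hr; rw [add_mul]; exact add_mem (iha r hr) (ihb r hr)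
    | neg a _ iha =>
      intro r hr
      -- The range is only available as an additive submonoid, so negation is done by the
      -- coefficient `-1`.
      rw [neg_mul, ← neg_one_mul]
      refine hmul _ (fun d i => ?_) _ (iha r hr)
      rw [← map_one (baseHom q n f), ← map_neg, ← mul_assoc, ← map_mul]
      exact baseHom_mul_mem_range q n f _ _
    | mul a b _ _ iha ihb => intro r hr; rw [mul_assoc]; exact iha _ (ihb r hr)
  intro r
  have h1 : (1 : 𝓡) ∈ normalRange q n f :=
    ⟨.single 0 1, by rw [normalForm_single, map_one]; simp [basisElt]⟩
  simpa only [mul_one] using! key r (by rw [AmbiskewAlgebra.closure_generators]; trivial) 1 h1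

end NormalForm

end AugmentedDownUpAlgebra

namespace AugmentedDownUpAlgebra

open LaurentPolynomial AugmentedDownUp

variable {K : Type*} [Field K] (q : Kˣ) (n : ℤ) (f : K[T;T⁻¹])

local notation "𝓡" => AugmentedDownUpAlgebra q n f
local notation "𝓒" => MvPolynomial (Fin 2) K

/-! ### Homogeneous components of images in the skew Laurent model -/

section Kernel

variable {L : Type*} [CommRing L] [Algebra K L] (c' z' : L)

theorem toSkewLaurent_centerHom (P : 𝓒) : toSkewLaurent q n f c' z' (centerHom q n f P) =
    .single 1 (LaurentPolynomial.C (MvPolynomial.aeval ![c', z'] P)) := by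
  induction P using MvPolynomial.induction_on with
  | C r =>
    rw [show (MvPolynomial.C r : 𝓒) = algebraMap K 𝓒 r from rfl, AlgHom.commutes, AlgHom.commutes]
    exact (toSkewLaurent q n f c' z').commutes r
  | add P Q hP hQ =>
    rw [map_add, map_add, map_add, Subalgebra.coe_add, map_add, hP, hQ,
      SkewMonoidAlgebra.single_add]
  | mul_X P i hP =>
    rw [map_mul, map_mul, map_mul, Subalgebra.coe_mul, map_mul, hP, MvPolynomial.aeval_X]
    have hX : toSkewLaurent q n f c' z' (centerHom q n f (MvPolynomial.X i)) =
        .single 1 (LaurentPolynomial.C (![c', z'] i)) := by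
      fin_cases i
      · exact (congrArg _ (centerHom_X_zero q n f)).trans (toSkewLaurent_c q n f c' z')
      · exact (congrArg _ (centerHom_X_one q n f)).trans (toSkewLaurent_z q n f c' z')
    rw [hX, SkewMonoidAlgebra.single_mul_single, one_smul, one_mul]

theorem toSkewLaurent_baseHom (d : 𝓒[T;T⁻¹]) : toSkewLaurent q n f c' z' (baseHom q n f d) =
    .single 1 (AddMonoidAlgebra.mapRingHom ℤ
      (MvPolynomial.aeval ![c', z'] : 𝓒 →ₐ[K] L).toRingHom d) := by
  induction d using LaurentPolynomial.induction_on' with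
  | add a b ha hb => rw [map_add, map_add, map_add, ha, hb, SkewMonoidAlgebra.single_add]
  | C_mul_T i P =>
    rw [baseHom_C_mul_T, map_mul, map_mul, toSkewLaurent_centerHom, toSkewLaurent_ofCoeff,
      coeffHom_C, mapRingHom_T, mapRingHom_T, mapRingHom_C, SkewMonoidAlgebra.single_mul_single,
      one_smul, one_mul]
    rfl

theorem toSkewLaurent_y_pow (m : ℕ) : toSkewLaurent q n f c' z' (y q n f ^ m) =
    .single (ScaleGroup.of _ m) 1 := by
  induction m with
  | zero => rw [pow_zero, map_one, Nat.cast_zero, ScaleGroup.of_zero, SkewMonoidAlgebra.one_def]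
  | succ m ih =>
    rw [pow_succ (y q n f) m, map_mul, ih, toSkewLaurent_y, SkewMonoidAlgebra.single_mul_single, smul_one,
      mul_one, ← ScaleGroup.of_add, Nat.cast_succ]

variable [IsDomain L]

/-- `W` is a product of translates of `w`, non-zero because `L[T;T⁻¹]` is a domain. -/
theorem exists_toSkewLaurent_x_pow (hw : weight n f c' z' ≠ 0) (m : ℕ) : ∃ W : L[T;T⁻¹], W ≠ 0 ∧
    toSkewLaurent q n f c' z' (x q n f ^ m) = .single (ScaleGroup.of _ (-m)) W := by
  induction m with
  | zero => exact ⟨1, one_ne_zero, by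
    rw [pow_zero, map_one, Nat.cast_zero, neg_zero, ScaleGroup.of_zero, SkewMonoidAlgebra.one_def]⟩
  | succ m ih =>
    obtain ⟨W, hW, h⟩ := ih
    refine ⟨W * ScaleGroup.of (q ^ 2) (-m) • weight n f c' z', mul_ne_zero hW
      fun h0 => hw ((smul_eq_zero_iff_eq _).1 h0), ?_⟩
    rw [pow_succ (x q n f) m, map_mul, h, toSkewLaurent_x, SkewMonoidAlgebra.single_mul_single,
      ← ScaleGroup.of_add, Nat.cast_succ, neg_add]

theorem exists_toSkewLaurent_basisElt (hw : weight n f c' z' ≠ 0) (i : ℤ) :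
    ∃ W : L[T;T⁻¹], W ≠ 0 ∧
      toSkewLaurent q n f c' z' (basisElt q n f i) = .single (ScaleGroup.of _ i) W := by
  obtain ⟨m, rfl | rfl⟩ := i.eq_nat_or_neg
  · exact ⟨1, one_ne_zero, by rw [basisElt_natCast, toSkewLaurent_y_pow]⟩
  · rw [basisElt_neg_natCast]
    exact exists_toSkewLaurent_x_pow q n f c' z' hw m

/-- The homogeneous components of the image of an element in normal form. -/
theorem exists_coeff_toSkewLaurent (hw : weight n f c' z' ≠ 0) : ∃ W : ℤ → L[T;T⁻¹],
    (∀ i, W i ≠ 0) ∧ ∀ (g : ℤ →₀ 𝓒[T;T⁻¹]) i,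
      (toSkewLaurent q n f c' z' (normalForm q n f g)).coeff (ScaleGroup.of _ i) =
        AddMonoidAlgebra.mapRingHom ℤ
          (MvPolynomial.aeval ![c', z'] : 𝓒 →ₐ[K] L).toRingHom (g i) * W i := by
  classical
  choose W hW h using exists_toSkewLaurent_basisElt q n f c' z' hw
  refine ⟨W, hW, fun g i => ?_⟩
  induction g using Finsupp.induction_linear with
  | zero => rw [map_zero, map_zero, Finsupp.zero_apply, map_zero, zero_mul]; rfl
  | add g g' hg hg' =>
    rw [map_add, map_add, SkewMonoidAlgebra.coeff_add, Finsupp.add_apply, hg, hg',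
      Finsupp.add_apply, map_add, add_mul]
  | single j d =>
    rw [normalForm_single, map_mul, toSkewLaurent_baseHom, h, SkewMonoidAlgebra.single_mul_single,
      one_mul, one_smul, SkewMonoidAlgebra.coeff_single_apply, Finsupp.single_apply]
    simp only [ScaleGroup.of_injective.eq_iff]
    split_ifs with hij
    · rw [hij]
    · rw [map_zero, zero_mul]

/-- Basis elements have distinct degrees and non-zero coefficients, which cancel degree by degree.
Taking `L = K[c, z]` gives injectivity of the model; taking `L = K[c, z]/(p)` computes its kernel.
-/
theorem map_eq_zero_of_toSkewLaurent_eq_zero (hw : weight n f c' z' ≠ 0) {g : ℤ →₀ 𝓒[T;T⁻¹]}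
    (hg : toSkewLaurent q n f c' z' (normalForm q n f g) = 0) (i : ℤ) :
    AddMonoidAlgebra.mapRingHom ℤ
      (MvPolynomial.aeval ![c', z'] : 𝓒 →ₐ[K] L).toRingHom (g i) = 0 := by
  obtain ⟨W, hW, h⟩ := exists_coeff_toSkewLaurent q n f c' z' hw
  have := h g i
  rw [hg] at this
  exact (mul_eq_zero.1 this.symm).resolve_right (hW i)

end Kernel

/-! ### The embedding, the domain property and the centre -/

theorem aeval_pair_X {L : Type*} [CommRing L] [Algebra K L] (φ : 𝓒 →ₐ[K] L) :
    MvPolynomial.aeval ![φ (MvPolynomial.X 0), φ (MvPolynomial.X 1)] = φ := by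
  refine MvPolynomial.algHom_ext fun i => ?_
  rw [MvPolynomial.aeval_X]
  fin_cases i <;> rfl

/-- The embedding into the skew Laurent polynomial ring over `K[c, z][k, k⁻¹]`. -/
noncomputable def embed : 𝓡 →ₐ[K] SkewMonoidAlgebra 𝓒[T;T⁻¹] (ScaleGroup (q ^ 2)) :=
  toSkewLaurent q n f (MvPolynomial.X 0) (MvPolynomial.X 1)

theorem aeval_X_X : (MvPolynomial.aeval ![MvPolynomial.X 0, MvPolynomial.X 1] : 𝓒 →ₐ[K] 𝓒) =
    AlgHom.id K 𝓒 := aeval_pair_X (AlgHom.id K 𝓒)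

theorem mapRingHom_aeval_X_X (d : 𝓒[T;T⁻¹]) : AddMonoidAlgebra.mapRingHom ℤ
    (MvPolynomial.aeval ![MvPolynomial.X 0, MvPolynomial.X 1] : 𝓒 →ₐ[K] 𝓒).toRingHom d = d := by
  rw [aeval_X_X]
  exact congrArg (fun g : 𝓒[T;T⁻¹] →+* 𝓒[T;T⁻¹] => g d) AddMonoidAlgebra.mapRingHom_id

theorem embed_baseHom (d : 𝓒[T;T⁻¹]) : embed q n f (baseHom q n f d) = .single 1 d := by
  rw [embed, toSkewLaurent_baseHom, mapRingHom_aeval_X_X]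

theorem embed_y : embed q n f (y q n f) = .single (ScaleGroup.of _ 1) 1 :=
  toSkewLaurent_y _ _ _ _ _

theorem baseHom_injective : Function.Injective (baseHom q n f) := fun a b h => by
  have := congrArg (embed q n f) h
  rw [embed_baseHom, embed_baseHom] at this
  exact SkewMonoidAlgebra.single_injective 1 this

theorem centerHom_injective : Function.Injective (centerHom q n f) := fun a b h => by
  have h' : baseHom q n f (LaurentPolynomial.C a) = baseHom q n f (LaurentPolynomial.C b) := by
    rw [baseHom_C, baseHom_C, h]
  have := congrArg (fun g : 𝓒[T;T⁻¹] => g.coeff 0) (baseHom_injective q n f h')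
  simpa using this

theorem centerHom_ne_zero {P : 𝓒} (hP : P ≠ 0) : (centerHom q n f P : 𝓡) ≠ 0 := fun h =>
  hP (centerHom_injective q n f ((Subtype.ext h).trans (map_zero (centerHom q n f)).symm))

theorem C_zpow_sub_one_ne_zero (hq : ∀ m : ℤ, m ≠ 0 → (q ^ 2) ^ m ≠ 1) {m : ℤ} (hm : m ≠ 0) :
    algebraMap K 𝓒 (((q ^ 2) ^ m : Kˣ) : K) - 1 ≠ 0 := by
  rw [← map_one (algebraMap K 𝓒), ← map_sub]
  refine (map_ne_zero_iff _ (MvPolynomial.C_injective (Fin 2) K)).2 (sub_ne_zero.2 fun h => ?_)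
  exact hq m hm (Units.ext h)

section

variable {n f} (hn : n ≠ 0) (hf : f.coeff n = 0)

include hn hf

theorem weight_X_ne_zero : weight n f (MvPolynomial.X 0 : 𝓒) (MvPolynomial.X 1) ≠ 0 :=
  weight_ne_zero _ _ _ _ hn hf (Or.inl (MvPolynomial.X_ne_zero 0))

theorem embed_injective : Function.Injective (embed q n f) := by
  refine (injective_iff_map_eq_zero _).2 fun r hr => ?_
  obtain ⟨g, rfl⟩ := normalForm_surjective q n f r
  have h : g = 0 := Finsupp.ext fun i => by
    have := map_eq_zero_of_toSkewLaurent_eq_zero q n f _ _ (weight_X_ne_zero hn hf) hr i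
    rwa [mapRingHom_aeval_X_X] at this
  rw [h, map_zero]

theorem isDomain : IsDomain 𝓡 := by
  have h1 : NoZeroDivisors 𝓡 := (embed_injective q hn hf).noZeroDivisors _ (map_zero _) (map_mul _)
  have h2 : Nontrivial 𝓡 := ⟨⟨0, 1, fun h => zero_ne_one
    (((map_zero (embed q n f)).symm.trans (congrArg _ h)).trans (map_one (embed q n f)))⟩⟩
  exact NoZeroDivisors.to_isDomain _

variable (hq : ∀ m : ℤ, m ≠ 0 → (q ^ 2) ^ m ≠ 1)

include hq

theorem centerHom_surjective : Function.Surjective (centerHom q n f) := by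
  rintro ⟨r, hr⟩
  obtain ⟨W, hW, h⟩ := exists_coeff_toSkewLaurent q n f (MvPolynomial.X 0 : 𝓒) (MvPolynomial.X 1)
    (weight_X_ne_zero hn hf)
  obtain ⟨g, rfl⟩ := normalForm_surjective q n f r
  rw [Subalgebra.mem_center_iff] at hr
  -- Commuting with `k` multiplies the component of degree `i` by `q²ⁱ - 1`, up to a unit, and must
  -- give zero.
  have hg : ∀ i, i ≠ 0 → g i = 0 := by
    intro i hi
    have h1 := congrArg (fun t => (embed q n f t).coeff (ScaleGroup.of _ i))
      (hr (baseHom q n f (T 1)))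
    simp only [map_mul, embed_baseHom] at h1
    rw [SkewMonoidAlgebra.coeff_single_one_mul, SkewMonoidAlgebra.coeff_mul_single_one, embed, h,
      mapRingHom_aeval_X_X, mul_comm] at h1
    have h2 : ScaleGroup.of (q ^ 2) i • (T 1 : 𝓒[T;T⁻¹]) =
        LaurentPolynomial.C (algebraMap K 𝓒 (((q ^ 2) ^ i : Kˣ) : K)) * T 1 := by
      rw [ScaleGroup.smul_def, rescale_T, zpow_one]
      rfl
    rw [h2] at h1
    have h3 : (g i * W i * T 1) *
        (LaurentPolynomial.C (algebraMap K 𝓒 (((q ^ 2) ^ i : Kˣ) : K) - 1)) = 0 := by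
      rw [map_sub, map_one, mul_sub, mul_one]
      nth_rewrite 2 [h1]
      ring
    have h4 : LaurentPolynomial.C (algebraMap K 𝓒 (((q ^ 2) ^ i : Kˣ) : K) - 1) ≠ 0 := fun h0 =>
      C_zpow_sub_one_ne_zero q hq hi (by
        have := congrArg (fun g : 𝓒[T;T⁻¹] => g.coeff 0) h0
        simpa using this)
    exact (mul_eq_zero.1 ((mul_eq_zero.1 ((mul_eq_zero.1 h3).resolve_right h4)).resolve_right
      (isUnit_T 1).ne_zero)).resolve_right (hW i)
  have hgs : g = Finsupp.single 0 (g 0) := by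
    classical
    ext1 i
    rw [Finsupp.single_apply]
    split_ifs with hi
    · rw [hi]
    · exact hg i (Ne.symm hi)
  have hnf : normalForm q n f g = baseHom q n f (g 0) := by
    conv_lhs => rw [hgs]
    rw [normalForm_single, show basisElt q n f 0 = 1 by simp [basisElt], mul_one]
  have h1 := congrArg (embed q n f) (hr (y q n f))
  rw [hnf, map_mul, map_mul, embed_baseHom, embed_y, SkewMonoidAlgebra.single_mul_single,
    SkewMonoidAlgebra.single_mul_single, one_mul, one_mul, mul_one, smul_one, mul_one] at h1
  -- Commuting with `y` makes `g 0` invariant under `k ↦ q² k`, so only its constant term survives.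
  have h2 : ScaleGroup.of (q ^ 2) 1 • g 0 = g 0 := SkewMonoidAlgebra.single_injective _ h1
  refine ⟨(g 0).coeff 0, Subtype.ext ?_⟩
  change (centerHom q n f ((g 0).coeff 0) : 𝓡) = normalForm q n f g
  rw [hnf, ← baseHom_C]
  congr 1
  apply LaurentPolynomial.ext
  intro j
  rw [C_apply]
  split_ifs with hj
  · rw [hj]
  · have h3 := congrArg (fun g : 𝓒[T;T⁻¹] => g.coeff j) h2
    simp only [ScaleGroup.coeff_smul, one_mul] at h3
    have h4 : (algebraMap K 𝓒 (((q ^ 2) ^ j : Kˣ) : K) - 1) * (g 0).coeff j = 0 := by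
      rw [sub_mul, h3, one_mul, sub_self]
    exact ((mul_eq_zero.1 h4).resolve_left (C_zpow_sub_one_ne_zero q hq hj)).symm

end

end AugmentedDownUpAlgebra

namespace AugmentedDownUpAlgebra

open LaurentPolynomial AugmentedDownUp

variable {K : Type*} [Field K] (q : Kˣ) (n : ℤ) (f : K[T;T⁻¹])

local notation "𝓡" => AugmentedDownUpAlgebra q n f
local notation "𝓒" => MvPolynomial (Fin 2) K

/-! ### Comaximality of the translates of the weight -/

/-- Over the field of fractions of `K[c, z]`, the Laurent polynomial `w = z + c kⁿ + f(k)` is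
comaximal with its translate `w(pᵐ k)`. -/
theorem exists_C_eq_mul_weight_add (hn : n ≠ 0) (hq : ∀ m : ℤ, m ≠ 0 → (q ^ 2) ^ m ≠ 1)
    {m : ℤ} (hm : m ≠ 0) : ∃ P : 𝓒, P ≠ 0 ∧ ∃ a b : 𝓒[T;T⁻¹], LaurentPolynomial.C P =
      a * weight n f (MvPolynomial.X 0) (MvPolynomial.X 1) +
      b * ScaleGroup.of (q ^ 2) m • weight n f (MvPolynomial.X 0) (MvPolynomial.X 1) := by
  set s : Kˣ := (q ^ 2) ^ m with hs
  -- `δ` is the factor of `c kⁿ` in the difference of `w` and its translate; it is non-zero because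
  -- `m n ≠ 0`.
  set δ : K := 1 - ((s ^ n : Kˣ) : K) with hδ
  have hδ0 : δ ≠ 0 := sub_ne_zero.2 fun h =>
    hq (m * n) (mul_ne_zero hm hn) (Units.ext (by rw [zpow_mul, ← hs, ← h, Units.val_one]))
  -- Setting `w` and its translate to zero gives two linear equations in `c` and `z`, with solution
  -- `c = g`, `z = h`.
  let g : K[T;T⁻¹] := -(LaurentPolynomial.C δ⁻¹ * T (-n) * (f - rescale s f))
  let h : K[T;T⁻¹] := -(g * T n + f)
  obtain ⟨P, hP0, hP⟩ := exists_aeval_eq_zero g h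
  refine ⟨P, hP0, ?_⟩
  let φ : K[T;T⁻¹] →ₐ[K] 𝓒[T;T⁻¹] :=
    (coeffHom (MvPolynomial.X 0)).comp (Algebra.ofId K[T;T⁻¹] K[T;T⁻¹][X] |>.restrictScalars K)
  have hφ : ∀ t, φ t = AddMonoidAlgebra.mapRingHom ℤ (algebraMap K 𝓒) t := fun t => coeffHom_C _ t
  set w : 𝓒[T;T⁻¹] := weight n f (MvPolynomial.X 0) (MvPolynomial.X 1) with hw
  have hw1 : w = LaurentPolynomial.C (MvPolynomial.X 1) +
      (LaurentPolynomial.C (MvPolynomial.X 0) * T n + φ f) := by rw [hw, weight_eq, hφ]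
  have hw2 : ScaleGroup.of (q ^ 2) m • w = LaurentPolynomial.C (MvPolynomial.X 1) +
      (LaurentPolynomial.C (MvPolynomial.X 0) * (φ (LaurentPolynomial.C (1 - δ)) * T n) +
        φ (rescale s f)) := by
    rw [hw1, smul_add, smul_add, smul_mul', ScaleGroup.smul_C, ScaleGroup.smul_C, hφ, hφ, hφ,
      algebraMap_map_rescale, mapRingHom_C, ScaleGroup.smul_def, ScaleGroup.smul_def, ← hs,
      rescale_T, ← map_zpow, hδ, sub_sub_cancel]
    rfl
  let J : Ideal 𝓒[T;T⁻¹] := Ideal.span {w, ScaleGroup.of (q ^ 2) m • w}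
  have hJ1 : w ∈ J := Ideal.subset_span (Or.inl rfl)
  have hJ2 : ScaleGroup.of (q ^ 2) m • w ∈ J := Ideal.subset_span (Or.inr rfl)
  have hTT : (T n : 𝓒[T;T⁻¹]) * T (-n) = 1 := by rw [← T_add, add_neg_cancel, T_zero]
  have hφT : ∀ i, φ (T i) = T i := fun i => by rw [hφ, mapRingHom_T]
  have hδδ : φ (LaurentPolynomial.C δ⁻¹) * φ (LaurentPolynomial.C δ) = 1 := by
    rw [← map_mul, ← map_mul, inv_mul_cancel₀ hδ0, map_one, map_one]
  have hg : LaurentPolynomial.C (MvPolynomial.X 0) - φ g ∈ J := by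
    have : LaurentPolynomial.C (MvPolynomial.X 0) - φ g = φ (LaurentPolynomial.C δ⁻¹) * T (-n) *
        (w - ScaleGroup.of (q ^ 2) m • w) := by
      rw [hw2, hw1, map_neg, map_mul, map_mul, map_sub, hφT, map_sub LaurentPolynomial.C, map_sub φ,
        map_one, map_one]
      linear_combination (-(LaurentPolynomial.C (MvPolynomial.X 0 : 𝓒))) * hδδ -
        LaurentPolynomial.C (MvPolynomial.X 0 : 𝓒) * φ (LaurentPolynomial.C δ⁻¹) *
          φ (LaurentPolynomial.C δ) * hTT
    rw [this]
    exact J.mul_mem_left _ (sub_mem hJ1 hJ2)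
  have hh : LaurentPolynomial.C (MvPolynomial.X 1) - φ h ∈ J := by
    have : LaurentPolynomial.C (MvPolynomial.X 1) - φ h =
        w - T n * (LaurentPolynomial.C (MvPolynomial.X 0) - φ g) := by
      rw [hw1, map_neg, map_add, map_mul, hφT]
      ring
    rw [this]
    exact sub_mem hJ1 (J.mul_mem_left _ hg)
  have hmem : LaurentPolynomial.C P ∈ J := by
    -- Modulo `J`, the map from `K[c, z]` factors through evaluation at `(g, h)`, which kills `P`.
    have heq : (Ideal.Quotient.mkₐ K J).comp (IsScalarTower.toAlgHom K 𝓒 𝓒[T;T⁻¹]) =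
        ((Ideal.Quotient.mkₐ K J).comp φ).comp (MvPolynomial.aeval ![g, h]) := by
      refine MvPolynomial.algHom_ext fun i => ?_
      rw [AlgHom.comp_apply, AlgHom.comp_apply, AlgHom.comp_apply, MvPolynomial.aeval_X]
      fin_cases i
      · exact Ideal.Quotient.eq.2 hg
      · exact Ideal.Quotient.eq.2 hh
    have := congrArg (fun ψ => ψ P) heq
    simp only [AlgHom.comp_apply, hP, map_zero] at this
    exact Ideal.Quotient.eq_zero_iff_mem.1 this
  obtain ⟨a, b, hab⟩ := Ideal.mem_span_pair.1 hmem
  exact ⟨a, b, hab.symm⟩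

/-! ### Non-zero ideals -/

theorem centerHom_mul_comm (P : 𝓒) (r : 𝓡) : (centerHom q n f P : 𝓡) * r = r * centerHom q n f P :=
  (commute_centerHom q n f P r).eq

theorem y_pow_mul_baseHom (m : ℕ) (d : 𝓒[T;T⁻¹]) : y q n f ^ m * baseHom q n f d =
    baseHom q n f (ScaleGroup.of (q ^ 2) m • d) * y q n f ^ m := by
  induction m generalizing d with
  | zero =>
    rw [pow_zero, one_mul, mul_one, Nat.cast_zero, ScaleGroup.of_zero, one_smul]
  | succ m ih =>
    rw [pow_succ (y q n f) m, mul_assoc, y_mul_baseHom, ← mul_assoc, ih, smul_smul,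
      ← ScaleGroup.of_add, mul_assoc, Nat.cast_succ]

theorem smul_C_mul_T (i j : ℤ) (P : 𝓒) :
    ScaleGroup.of (q ^ 2) i • (LaurentPolynomial.C P * T j : 𝓒[T;T⁻¹]) =
      LaurentPolynomial.C (algebraMap K 𝓒 (((q ^ 2) ^ (i * j) : Kˣ) : K) * P) * T j := by
  rw [smul_mul', ScaleGroup.smul_C, ScaleGroup.smul_def, rescale_T, ← map_zpow, ← zpow_mul, map_mul]
  simp only [Units.coe_map, MonoidHom.coe_coe]
  ring

/-- The monomial `s kʲ yⁱ`. -/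
noncomputable def monomialElt (s : 𝓒) (j : ℤ) (i : ℕ) : 𝓡 :=
  baseHom q n f (LaurentPolynomial.C s * T j) * y q n f ^ i

theorem monomialElt_sub (s t : 𝓒) (j : ℤ) (i : ℕ) :
    monomialElt q n f (s - t) j i = monomialElt q n f s j i - monomialElt q n f t j i := by
  rw [monomialElt, map_sub, sub_mul, map_sub, sub_mul]; rfl

theorem centerHom_mul_monomialElt (P s : 𝓒) (j : ℤ) (i : ℕ) :
    (centerHom q n f P : 𝓡) * monomialElt q n f s j i = monomialElt q n f (P * s) j i := by
  rw [monomialElt, ← baseHom_C, ← mul_assoc, ← map_mul, ← mul_assoc, ← map_mul]; rfl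

theorem y_mul_monomialElt (s : 𝓒) (j : ℤ) (i : ℕ) : y q n f * monomialElt q n f s j i =
    monomialElt q n f (algebraMap K 𝓒 (((q ^ 2) ^ j : Kˣ) : K) * s) j (i + 1) := by
  rw [monomialElt, ← mul_assoc, y_mul_baseHom, smul_C_mul_T, one_mul, mul_assoc, ← pow_succ']; rfl

theorem monomialElt_mul_y (s : 𝓒) (j : ℤ) (i : ℕ) :
    monomialElt q n f s j i * y q n f = monomialElt q n f s j (i + 1) := by
  rw [monomialElt, mul_assoc, ← pow_succ]; rfl

theorem conj_monomialElt (s : 𝓒) (j : ℤ) (i : ℕ) :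
    baseHom q n f (T (-1)) * monomialElt q n f s j i * baseHom q n f (T 1) =
      monomialElt q n f (algebraMap K 𝓒 (((q ^ 2) ^ (i : ℤ) : Kˣ) : K) * s) j i := by
  have h := smul_C_mul_T q i 1 1
  rw [map_one, one_mul, mul_one, mul_one] at h
  rw [monomialElt, mul_assoc, mul_assoc, y_pow_mul_baseHom, h, ← mul_assoc, ← mul_assoc, ← map_mul,
    ← map_mul, monomialElt]
  congr 2
  have h1 : (T (-1) : 𝓒[T;T⁻¹]) * T 1 = 1 := by rw [← T_add, neg_add_cancel, T_zero]
  rw [map_mul]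
  linear_combination (LaurentPolynomial.C s * T j *
    LaurentPolynomial.C (algebraMap K 𝓒 (((q ^ 2) ^ (i : ℤ) : Kˣ) : K))) * h1

variable {q} in
theorem algebraMap_zpow_sub_ne_zero (hq : ∀ m : ℤ, m ≠ 0 → (q ^ 2) ^ m ≠ 1) {i j : ℤ} (hij : i ≠ j) :
    algebraMap K 𝓒 (((q ^ 2) ^ i : Kˣ) : K) - algebraMap K 𝓒 (((q ^ 2) ^ j : Kˣ) : K) ≠ 0 := by
  rw [← map_sub]
  refine (map_ne_zero_iff _ (MvPolynomial.C_injective (Fin 2) K)).2 (sub_ne_zero.2 fun h => ?_)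
  exact hq (i - j) (sub_ne_zero.2 hij) (by rw [zpow_sub, Units.ext h, mul_inv_cancel])

/-- An ideal that contains a non-zero combination of monomials `kʲ yⁱ` contains a
non-zero multiple of a power of `y` by a polynomial in `c` and `z`. -/
theorem exists_centerHom_mul_y_pow_mem (hq : ∀ m : ℤ, m ≠ 0 → (q ^ 2) ^ m ≠ 1)
    (I : TwoSidedIdeal 𝓡) (S : Finset (ℤ × ℕ)) :
    ∀ (g : ℤ × ℕ → 𝓒) (N : ℕ), (∃ a ∈ S, g a ≠ 0) →
      ∑ a ∈ S, monomialElt q n f (g a) a.1 (a.2 + N) ∈ I →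
      ∃ s : 𝓒, s ≠ 0 ∧ ∃ m : ℕ, (centerHom q n f s : 𝓡) * y q n f ^ m ∈ I := by
  classical
  induction S using Finset.strongInduction with
  | H S ih =>
    rintro g N ⟨a, haS, ha⟩ hI
    by_cases hb : ∃ b ∈ S, b ≠ a ∧ g b ≠ 0
    · obtain ⟨b, hbS, hba, hb⟩ := hb
      -- An operation inside `I` that multiplies the monomials by factors `μ`, killing `a` but not
      -- `b`, shortens the sum.
      have key : ∀ (μ : ℤ × ℕ → 𝓒) (N' : ℕ), μ a = 0 → μ b ≠ 0 →
          ∑ i ∈ S, monomialElt q n f (μ i * g i) i.1 (i.2 + N') ∈ I →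
          ∃ s : 𝓒, s ≠ 0 ∧ ∃ m : ℕ, (centerHom q n f s : 𝓡) * y q n f ^ m ∈ I := by
        intro μ N' hμa hμb hμ
        refine ih (S.erase a) (Finset.erase_ssubset haS) (fun i => μ i * g i) N'
          ⟨b, Finset.mem_erase.2 ⟨hba, hbS⟩, mul_ne_zero hμb hb⟩ ?_
        rw [← Finset.add_sum_erase S _ haS] at hμ
        have h0 : monomialElt q n f (μ a * g a) a.1 (a.2 + N') = 0 := by
          rw [hμa, zero_mul, monomialElt, map_zero, zero_mul, map_zero, zero_mul]
        rwa [h0, zero_add] at hμ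
      by_cases h2 : b.2 = a.2
      -- Equal powers of `y`: use `y r - q^(2 a.1) r y`, which separates powers of `k`. It raises
      -- every `y`-degree by one, recorded by `N + 1` with the index set unchanged.
      · have h1 : b.1 ≠ a.1 := fun h => hba (Prod.ext h h2)
        refine key (fun i => algebraMap K 𝓒 (((q ^ 2) ^ i.1 : Kˣ) : K) -
          algebraMap K 𝓒 (((q ^ 2) ^ a.1 : Kˣ) : K)) (N + 1) (sub_self _)
          (algebraMap_zpow_sub_ne_zero hq h1) ?_
        have h3 := I.sub_mem (I.mul_mem_left (y q n f) _ hI) (I.mul_mem_left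
          (centerHom q n f (algebraMap K 𝓒 (((q ^ 2) ^ a.1 : Kˣ) : K)) : 𝓡) _
          (I.mul_mem_right _ (y q n f) hI))
        rw [Finset.mul_sum, Finset.sum_mul, Finset.mul_sum, ← Finset.sum_sub_distrib] at h3
        convert h3 using 1
        refine Finset.sum_congr rfl fun i _ => ?_
        rw [y_mul_monomialElt, monomialElt_mul_y, centerHom_mul_monomialElt, ← monomialElt_sub,
          sub_mul, add_assoc]
      -- Different powers of `y`: conjugation by `k` scales a monomial according to its `y`-degree.
      · refine key (fun i => algebraMap K 𝓒 (((q ^ 2) ^ ((i.2 + N : ℕ) : ℤ) : Kˣ) : K) -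
          algebraMap K 𝓒 (((q ^ 2) ^ ((a.2 + N : ℕ) : ℤ) : Kˣ) : K)) N (sub_self _)
          (algebraMap_zpow_sub_ne_zero hq (by omega)) ?_
        have h3 := I.sub_mem (I.mul_mem_right _ (baseHom q n f (T 1))
          (I.mul_mem_left (baseHom q n f (T (-1))) _ hI)) (I.mul_mem_left
          (centerHom q n f (algebraMap K 𝓒 (((q ^ 2) ^ ((a.2 + N : ℕ) : ℤ) : Kˣ) : K)) : 𝓡) _ hI)
        rw [Finset.mul_sum, Finset.sum_mul, Finset.mul_sum, ← Finset.sum_sub_distrib] at h3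
        convert h3 using 1
        refine Finset.sum_congr rfl fun i _ => ?_
        rw [conj_monomialElt, centerHom_mul_monomialElt, ← monomialElt_sub, sub_mul]
    · push Not at hb
      rw [Finset.sum_eq_single_of_mem a haS fun b hbS hba => by
        rw [hb b hbS hba, monomialElt, map_zero, zero_mul, map_zero, zero_mul]] at hI
      refine ⟨g a, ha, a.2 + N, ?_⟩
      have h3 := I.mul_mem_left (baseHom q n f (T (-a.1))) _ hI
      rwa [monomialElt, ← mul_assoc, ← map_mul, T_mul, mul_assoc _ (T a.1), ← T_add, add_neg_cancel,
        T_zero, mul_one, baseHom_C] at h3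

/-- Finite sums of the monomials `s kʲ yⁱ`. -/
def monomialSpan : AddSubmonoid 𝓡 where
  carrier := {r | ∃ g : ℤ × ℕ →₀ 𝓒, r = g.sum fun a s => monomialElt q n f s a.1 a.2}
  zero_mem' := ⟨0, Finsupp.sum_zero_index.symm⟩
  add_mem' := by
    classical
    rintro _ _ ⟨g, rfl⟩ ⟨h, rfl⟩
    refine ⟨g + h, (Finsupp.sum_add_index' (fun a => ?_) fun a s t => ?_).symm⟩
    · rw [monomialElt, map_zero, zero_mul, map_zero, zero_mul]
    · rw [monomialElt, map_add, add_mul, map_add, add_mul]; rfl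

theorem baseHom_mul_y_pow_mem (d : 𝓒[T;T⁻¹]) (i : ℕ) :
    baseHom q n f d * y q n f ^ i ∈ monomialSpan q n f := by
  induction d using LaurentPolynomial.induction_on' with
  | add a b ha hb => rw [map_add, add_mul]; exact add_mem ha hb
  | C_mul_T j s =>
    refine ⟨Finsupp.single (j, i) s, ?_⟩
    rw [Finsupp.sum_single_index]
    · rfl
    · rw [monomialElt, map_zero, zero_mul, map_zero, zero_mul]

theorem exists_x_pow_mul_y_pow (m : ℕ) : ∃ d, x q n f ^ m * y q n f ^ m = baseHom q n f d := by
  induction m with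
  | zero => exact ⟨1, by rw [pow_zero, pow_zero, map_one, mul_one]⟩
  | succ m ih =>
    obtain ⟨d, hd⟩ := ih
    refine ⟨ScaleGroup.of (q ^ 2) (-1) • d * weight n f (MvPolynomial.X 0) (MvPolynomial.X 1), ?_⟩
    rw [pow_succ' (x q n f) m, pow_succ (y q n f) m, mul_assoc, ← mul_assoc (x q n f ^ m), hd,
      ← mul_assoc, x_mul_baseHom, mul_assoc, ← baseHom_weight, ← map_mul]

theorem exists_mul_y_pow_mem (r : 𝓡) : ∃ N : ℕ, r * y q n f ^ N ∈ monomialSpan q n f := by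
  -- Asking for all large exponents lets a sum use the maximum of two bounds; each `xᵐ yᵐ` lies in
  -- the base ring.
  suffices h : ∃ N : ℕ, ∀ N' ≥ N, r * y q n f ^ N' ∈ monomialSpan q n f from
    ⟨h.choose, h.choose_spec _ le_rfl⟩
  obtain ⟨g, rfl⟩ := normalForm_surjective q n f r
  induction g using Finsupp.induction_linear with
  | zero => exact ⟨0, fun _ _ => by rw [map_zero, zero_mul]; exact zero_mem _⟩
  | add g h hg hh =>
    obtain ⟨N, hN⟩ := hg
    obtain ⟨M, hM⟩ := hh
    refine ⟨max N M, fun N' hN' => ?_⟩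
    rw [map_add, add_mul]
    exact add_mem (hN _ ((le_max_left _ _).trans hN')) (hM _ ((le_max_right _ _).trans hN'))
  | single i d =>
    rw [normalForm_single]
    obtain ⟨m, rfl | rfl⟩ := i.eq_nat_or_neg
    · refine ⟨0, fun N' _ => ?_⟩
      rw [basisElt_natCast, mul_assoc, ← pow_add]
      exact baseHom_mul_y_pow_mem q n f _ _
    · refine ⟨m, fun N' hN' => ?_⟩
      obtain ⟨d', hd'⟩ := exists_x_pow_mul_y_pow q n f m
      obtain ⟨k, rfl⟩ := Nat.exists_eq_add_of_le hN'
      rw [basisElt_neg_natCast, mul_assoc, pow_add, ← mul_assoc (x q n f ^ m), hd', ← mul_assoc,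
        ← map_mul]
      exact baseHom_mul_y_pow_mem q n f _ _

section

variable {n f} (hn : n ≠ 0) (hf : f.coeff n = 0) (hq : ∀ m : ℤ, m ≠ 0 → (q ^ 2) ^ m ≠ 1)

include hn hq

/-- From `s yᵐ⁺¹`, left multiplication by `x` gives `s w yᵐ`. Right multiplication gives `s yᵐ (y
x)`, which is `s yᵐ` preceded by the translate of `w` by `m + 1` steps. Comaximality combines them
into `P s yᵐ`. -/
theorem exists_centerHom_mem (I : TwoSidedIdeal 𝓡) (m : ℕ) {s : 𝓒} (hs : s ≠ 0)
    (hI : (centerHom q n f s : 𝓡) * y q n f ^ m ∈ I) :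
    ∃ s : 𝓒, s ≠ 0 ∧ (centerHom q n f s : 𝓡) ∈ I := by
  induction m generalizing s with
  | zero => exact ⟨s, hs, by rwa [pow_zero, mul_one] at hI⟩
  | succ m ih =>
    obtain ⟨P, hP, a, b, hab⟩ := exists_C_eq_mul_weight_add q n f hn hq
      (m := (m : ℤ) + 1) (by omega)
    refine ih (mul_ne_zero hP hs) ?_
    have h1 : (centerHom q n f s : 𝓡) *
        (baseHom q n f (weight n f (MvPolynomial.X 0) (MvPolynomial.X 1)) * y q n f ^ m) ∈ I := by
      have := I.mul_mem_left (x q n f) _ hI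
      rwa [← mul_assoc, ← centerHom_mul_comm, mul_assoc, pow_succ' (y q n f) m,
        ← mul_assoc (x q n f), ← baseHom_weight] at this
    have h2 : (centerHom q n f s : 𝓡) * (baseHom q n f (ScaleGroup.of (q ^ 2) ((m : ℤ) + 1) •
        weight n f (MvPolynomial.X 0) (MvPolynomial.X 1)) * y q n f ^ m) ∈ I := by
      have := I.mul_mem_right _ (x q n f) hI
      rwa [mul_assoc, pow_succ (y q n f) m, mul_assoc (y q n f ^ m), ← baseHom_smul_weight,
        y_pow_mul_baseHom, smul_smul, ← ScaleGroup.of_add] at this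
    have h3 := I.add_mem (I.mul_mem_left (baseHom q n f a) _ h1)
      (I.mul_mem_left (baseHom q n f b) _ h2)
    convert h3 using 1
    rw [← mul_assoc (baseHom q n f a), ← mul_assoc (baseHom q n f b), ← centerHom_mul_comm,
      ← centerHom_mul_comm, mul_assoc _ (baseHom q n f a), mul_assoc _ (baseHom q n f b),
      ← mul_assoc (baseHom q n f a), ← mul_assoc (baseHom q n f b), ← map_mul, ← map_mul, ← mul_add,
      ← add_mul, ← map_add, ← hab, baseHom_C, map_mul, Subalgebra.coe_mul, centerHom_mul_comm,
      mul_assoc]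

include hf

/-- Every non-zero ideal contains a non-zero polynomial in `c` and `z`. -/
theorem exists_centerHom_mem_of_ne_bot (I : TwoSidedIdeal 𝓡) (hI : I ≠ ⊥) :
    ∃ s : 𝓒, s ≠ 0 ∧ (centerHom q n f s : 𝓡) ∈ I := by
  have := isDomain q hn hf
  obtain ⟨r, hrI, hr⟩ : ∃ r ∈ I, r ≠ 0 := by
    by_contra! h
    exact hI (eq_bot_iff.2 fun r hr => (TwoSidedIdeal.mem_bot _).2 (h r hr))
  obtain ⟨N, g, hg⟩ := exists_mul_y_pow_mem q n f r
  have hy : y q n f ≠ 0 := fun h0 => by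
    have h1 := embed_y q n f
    rw [h0, map_zero] at h1
    exact one_ne_zero (SkewMonoidAlgebra.single_eq_zero.1 h1.symm)
  have hgI : g.sum (fun a s => monomialElt q n f s a.1 a.2) ∈ I := hg ▸ I.mul_mem_right _ _ hrI
  have hg0 : ∃ a ∈ g.support, g a ≠ 0 := by
    by_contra! h
    have : g = 0 := Finsupp.support_eq_empty.1 (Finset.eq_empty_of_forall_notMem fun a ha =>
      Finsupp.mem_support_iff.1 ha (h a ha))
    rw [this, Finsupp.sum_zero_index] at hg
    exact mul_ne_zero hr (pow_ne_zero N hy) hg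
  obtain ⟨s, hs, m, hm⟩ := exists_centerHom_mul_y_pow_mem q n f hq I g.support g 0 hg0 hgI
  exact exists_centerHom_mem q hn hq I m hs hm

end

end AugmentedDownUpAlgebra

/-! ### Height one primes -/

namespace TwoSidedIdeal

variable {R : Type*} [Ring R]

theorem isPrimeIdeal_bot [IsDomain R] : (⊥ : TwoSidedIdeal R).IsPrimeIdeal where
  ne_top h := one_ne_zero ((mem_bot R).1 (h ▸ (mem_top R : (1 : R) ∈ (⊤ : TwoSidedIdeal R))))
  mem_or_mem a b h := by
    have := (mem_bot R).1 (h 1)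
    rw [mul_one] at this
    simpa only [mem_bot] using mul_eq_zero.1 this

/-- In a domain the height one primes are the minimal non-zero primes. -/
theorem isHeightOnePrime_iff [IsDomain R] {P : TwoSidedIdeal R} (hP : P.IsPrimeIdeal) :
    P.IsHeightOnePrime ↔ P ≠ ⊥ ∧ ∀ Q : TwoSidedIdeal R, Q.IsPrimeIdeal → Q ≠ ⊥ → Q ≤ P → Q = P := by
  let Z : {Q : TwoSidedIdeal R // Q.IsPrimeIdeal} := ⟨⊥, isPrimeIdeal_bot⟩
  have hlt : ∀ Q : {Q : TwoSidedIdeal R // Q.IsPrimeIdeal}, Q.1 ≠ ⊥ → Z < Q := fun Q hQ =>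
    show (⊥ : TwoSidedIdeal R) < Q.1 from bot_lt_iff_ne_bot.2 hQ
  have hmin : IsMin Z := fun Q _ => show (⊥ : TwoSidedIdeal R) ≤ Q.1 from bot_le
  have hheight : ∀ Q : {Q : TwoSidedIdeal R // Q.IsPrimeIdeal}, Q.1 ≠ ⊥ → 1 ≤ Order.height Q :=
    fun Q hQ => by
      have := Order.height_add_one_le (hlt Q hQ)
      rwa [Order.height_eq_zero.2 hmin, zero_add] at this
  constructor
  · rintro ⟨_, h⟩
    refine ⟨?_, fun Q hQ hQ0 hQP => ?_⟩
    · rintro rfl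
      rw [Order.height_eq_zero.2 hmin] at h
      exact zero_ne_one h
    · by_contra hne
      have h1 := Order.height_add_one_le (a := (⟨Q, hQ⟩ : {Q : TwoSidedIdeal R // Q.IsPrimeIdeal}))
        (b := ⟨P, hP⟩) (lt_of_le_of_ne hQP fun he => hne (congrArg Subtype.val he))
      rw [h] at h1
      have h2 := (add_le_add_left (hheight ⟨Q, hQ⟩ hQ0) 1).trans h1
      exact absurd h2 (by decide)
  · rintro ⟨h0, h⟩
    refine ⟨hP, le_antisymm (Order.height_le_coe_iff (n := 1) |>.2 fun Q hQ => ?_) (hheight ⟨P, hP⟩ h0)⟩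
    have hQ0 : Q.1 = ⊥ := by
      by_contra hQ0
      exact hQ.ne (Subtype.ext (h Q.1 Q.2 hQ0 hQ.le))
    have hQZ : Q = Z := Subtype.ext hQ0
    rw [hQZ, Order.height_eq_zero.2 hmin]
    exact zero_lt_one

theorem isPrimeIdeal_ker {B : Type*} [Ring B] [IsDomain B] (φ : R →+* B) :
    (ker φ).IsPrimeIdeal where
  ne_top h := by
    have h1 : (1 : R) ∈ ker φ := h ▸ mem_top R
    rw [mem_ker, map_one] at h1
    exact one_ne_zero h1
  mem_or_mem a b h := by
    have h1 := h 1
    simp only [mem_ker, map_mul, mul_one] at h1 ⊢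
    exact mul_eq_zero.1 h1

theorem isDomain_quotient_ker {B : Type*} [Ring B] [IsDomain B] (φ : R →+* B) :
    IsDomain (ker φ).ringCon.Quotient := by
  have h1 : NoZeroDivisors (ker φ).ringCon.Quotient := ⟨fun {a b} hab => by
    obtain ⟨a, rfl⟩ := (ker φ).ringCon.mk'_surjective a
    obtain ⟨b, rfl⟩ := (ker φ).ringCon.mk'_surjective b
    have hiff : ∀ r, (ker φ).ringCon.mk' r = 0 ↔ φ r = 0 := fun r => by
      rw [← mem_ker, ker_ringCon_mk', mem_ker]
    rw [← map_mul, hiff, map_mul] at hab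
    rw [hiff, hiff]
    exact mul_eq_zero.1 hab⟩
  have h2 : Nontrivial (ker φ).ringCon.Quotient := ⟨⟨0, 1, fun h => by
    have h3 : (1 : R) ∈ ker (ker φ).ringCon.mk' := by rw [mem_ker, map_one, h]
    rw [ker_ringCon_mk', mem_ker, map_one] at h3
    exact one_ne_zero h3⟩⟩
  exact NoZeroDivisors.to_isDomain _

end TwoSidedIdeal

/-! ### Prime ideals generated by primes of `K[c, z]` -/

namespace AugmentedDownUpAlgebra

open LaurentPolynomial AugmentedDownUp

variable {K : Type*} [Field K] (q : Kˣ) (n : ℤ) (f : K[T;T⁻¹])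

local notation "𝓡" => AugmentedDownUpAlgebra q n f
local notation "𝓒" => MvPolynomial (Fin 2) K

/-- The ring `K[c, z] / (p)`. -/
def Residue (p : 𝓒) : Type _ := 𝓒 ⧸ Ideal.span {p}

noncomputable instance (p : 𝓒) : CommRing (Residue p) := inferInstanceAs (CommRing (𝓒 ⧸ Ideal.span {p}))

noncomputable instance (p : 𝓒) : Algebra K (Residue p) :=
  inferInstanceAs (Algebra K (𝓒 ⧸ Ideal.span {p}))

/-- The quotient map `K[c, z] → K[c, z] / (p)`. -/
noncomputable def residueHom (p : 𝓒) : 𝓒 →ₐ[K] Residue p := Ideal.Quotient.mkₐ K (Ideal.span {p})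

theorem residueHom_eq_zero_iff {p P : 𝓒} : residueHom p P = 0 ↔ p ∣ P :=
  Ideal.Quotient.eq_zero_iff_mem.trans Ideal.mem_span_singleton

theorem isDomain_residue {p : 𝓒} (hp : Prime p) : IsDomain (Residue p) :=
  have : (Ideal.span {p}).IsPrime := (Ideal.span_singleton_prime hp.ne_zero).2 hp
  Ideal.Quotient.isDomain (Ideal.span {p})

/-- The reduction of the skew Laurent model modulo an element of `K[c, z]`. -/
noncomputable def reduction (p : 𝓒) :
    𝓡 →ₐ[K] SkewMonoidAlgebra (Residue p)[T;T⁻¹] (ScaleGroup (q ^ 2)) :=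
  toSkewLaurent q n f (residueHom p (MvPolynomial.X 0))
    (residueHom p (MvPolynomial.X 1))

theorem reduction_centerHom (p P : 𝓒) : reduction q n f p (centerHom q n f P) =
    .single 1 (LaurentPolynomial.C (residueHom p P)) := by
  rw [reduction, toSkewLaurent_centerHom, aeval_pair_X]

theorem isDomain_reduction {p : 𝓒} (hp : Prime p) :
    IsDomain (SkewMonoidAlgebra (Residue p)[T;T⁻¹] (ScaleGroup (q ^ 2))) := by
  have := isDomain_residue hp
  exact NoZeroDivisors.to_isDomain _

theorem isPrimeIdeal_ker_reduction {p : 𝓒} (hp : Prime p) :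
    (TwoSidedIdeal.ker (reduction q n f p).toRingHom).IsPrimeIdeal :=
  have := isDomain_reduction q hp
  TwoSidedIdeal.isPrimeIdeal_ker (reduction q n f p).toRingHom

theorem isDomain_quotient_ker_reduction {p : 𝓒} (hp : Prime p) :
    IsDomain (TwoSidedIdeal.ker (reduction q n f p).toRingHom).ringCon.Quotient :=
  have := isDomain_reduction q hp
  TwoSidedIdeal.isDomain_quotient_ker (reduction q n f p).toRingHom

variable {n f} (hn : n ≠ 0) (hf : f.coeff n = 0)

include hn hf

/-- Otherwise `p` divides both `c` and `z + a₀`; then `p` is associated to `c`, and `c` would divide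
`z + a₀`. -/
theorem weight_mk_ne_zero {p : 𝓒} (hp : Prime p) :
    weight n f (residueHom p (MvPolynomial.X 0))
      (residueHom p (MvPolynomial.X 1)) ≠ 0 := by
  refine weight_ne_zero _ _ _ _ hn hf ?_
  by_contra! h
  obtain ⟨h0, h1⟩ := h
  rw [← AlgHom.commutes (residueHom p), ← map_add] at h1
  have h0' := residueHom_eq_zero_iff.1 h0
  have h1' := residueHom_eq_zero_iff.1 h1
  have hassoc : Associated p (MvPolynomial.X 0 : 𝓒) :=
    hp.associated_of_dvd (MvPolynomial.X_prime) h0'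
  obtain ⟨t, ht⟩ := hassoc.symm.dvd.trans h1'
  -- At this point `c` vanishes while `z + a₀` equals `1`.
  have := congrArg (MvPolynomial.aeval ![(0 : K), 1 - f.coeff 0]) ht
  simp at this

/-- For a prime `p` of `K[c, z]`, the kernel of the reduction modulo `p` is generated by `p`. -/
theorem mem_ker_reduction_iff {p : 𝓒} (hp : Prime p) (r : 𝓡) :
    r ∈ TwoSidedIdeal.ker (reduction q n f p).toRingHom ↔ ∃ s, r = centerHom q n f p * s := by
  have := isDomain_residue hp
  rw [TwoSidedIdeal.mem_ker]
  constructor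
  · intro hr
    obtain ⟨g, rfl⟩ := normalForm_surjective q n f r
    have hg := map_eq_zero_of_toSkewLaurent_eq_zero q n f _ _ (weight_mk_ne_zero hn hf hp) hr
    -- Vanishing modulo `p` is divisibility of every coefficient of every power of `k`, so `p`
    -- factors out of the whole normal form.
    have hdvd : ∀ i, ∃ d, g i = LaurentPolynomial.C p * d := by
      intro i
      have hi := hg i
      rw [aeval_pair_X] at hi
      have hc : ∀ j, ∃ t, (g i).coeff j = p * t := fun j => by
        have h2 := congrArg (fun d : (Residue p)[T;T⁻¹] => d.coeff j) hi
        simp only [AddMonoidAlgebra.coeff_mapRingHom] at h2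
        exact residueHom_eq_zero_iff.1 h2
      choose t ht using hc
      refine ⟨∑ j ∈ (g i).coeff.support, LaurentPolynomial.C (t j) * T j, ?_⟩
      rw [Finset.mul_sum]
      apply LaurentPolynomial.ext
      intro j
      rw [AddMonoidAlgebra.coeff_sum, Finsupp.finsetSum_apply]
      simp only [← mul_assoc, ← map_mul, coeff_C_mul_T, ← ht]
      rw [Finset.sum_ite_eq']
      split_ifs with hj
      · rfl
      · exact Finsupp.notMem_support_iff.1 hj
    choose d hd using hdvd
    refine ⟨∑ i ∈ g.support, baseHom q n f (d i) * basisElt q n f i, ?_⟩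
    rw [normalForm_apply, Finsupp.sum, Finset.mul_sum]
    refine Finset.sum_congr rfl fun i _ => ?_
    rw [hd i, map_mul, baseHom_C, mul_assoc]
  · rintro ⟨s, rfl⟩
    have h0 : reduction q n f p (centerHom q n f p) = 0 := by
      rw [reduction_centerHom, residueHom_eq_zero_iff.2 dvd_rfl,
        map_zero, SkewMonoidAlgebra.single_zero]
    exact (map_mul (reduction q n f p) _ _).trans (by rw [h0, zero_mul])

theorem ker_reduction_ne_bot {p : 𝓒} (hp : Prime p) :
    TwoSidedIdeal.ker (reduction q n f p).toRingHom ≠ ⊥ := fun h => by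
  have h1 := (mem_ker_reduction_iff q hn hf hp _).2 ⟨1, (mul_one (centerHom q n f p : 𝓡)).symm⟩
  rw [h, TwoSidedIdeal.mem_bot] at h1
  exact centerHom_ne_zero q n f hp.ne_zero h1

theorem ker_reduction_le {p : 𝓒} (hp : Prime p) {P : TwoSidedIdeal 𝓡}
    (hP : (centerHom q n f p : 𝓡) ∈ P) : TwoSidedIdeal.ker (reduction q n f p).toRingHom ≤ P := by
  intro r hr
  obtain ⟨s, rfl⟩ := (mem_ker_reduction_iff q hn hf hp _).1 hr
  exact P.mul_mem_right _ _ hP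

variable (hq : ∀ m : ℤ, m ≠ 0 → (q ^ 2) ^ m ≠ 1)

include hq

/-- Every non-zero prime ideal contains a prime of `K[c, z]`. -/
theorem exists_prime_mem {P : TwoSidedIdeal 𝓡} (hP : P.IsPrimeIdeal) (h0 : P ≠ ⊥) :
    ∃ p : 𝓒, Prime p ∧ (centerHom q n f p : 𝓡) ∈ P := by
  obtain ⟨s, hs, hsP⟩ := exists_centerHom_mem_of_ne_bot q hn hf hq P h0
  have hunit : ∀ t : 𝓒, IsUnit t → (centerHom q n f t : 𝓡) ∉ P := by
    rintro t ht h
    obtain ⟨t', ht'⟩ := ht.exists_left_inv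
    refine hP.ne_top ((TwoSidedIdeal.one_mem_iff P).1 ?_)
    have := P.mul_mem_left (centerHom q n f t' : 𝓡) _ h
    rwa [← Subalgebra.coe_mul, ← map_mul, ht', map_one] at this
  induction s using UniqueFactorizationMonoid.induction_on_prime with
  | h₁ => exact absurd rfl hs
  | h₂ t ht => exact absurd hsP (hunit t ht)
  | h₃ t p ht hp ih =>
    rw [map_mul, Subalgebra.coe_mul] at hsP
    -- Central factors commute past `r`, so membership of their product suffices for primeness.
    rcases hP.mem_or_mem _ _ (fun r => by
      rw [mul_assoc, ← centerHom_mul_comm q n f t, ← mul_assoc]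
      exact P.mul_mem_right _ _ hsP) with h | h
    · exact ⟨p, hp, h⟩
    · exact ih ht h

/-- A non-zero prime ideal inside `cR` contains a prime `p` of `K[c, z]`. Then `c` divides `p`, so
they are associated and the ideal contains `c`. -/
theorem isHeightOnePrime_ker_reduction_X :
    (TwoSidedIdeal.ker (reduction q n f (MvPolynomial.X 0)).toRingHom).IsHeightOnePrime := by
  have := isDomain q hn hf
  have hX : Prime (MvPolynomial.X 0 : 𝓒) := MvPolynomial.X_prime
  refine (TwoSidedIdeal.isHeightOnePrime_iff (isPrimeIdeal_ker_reduction q n f hX)).2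
    ⟨ker_reduction_ne_bot q hn hf hX, fun Q hQ hQ0 hle => le_antisymm hle ?_⟩
  obtain ⟨p, hp, hpQ⟩ := exists_prime_mem q hn hf hq hQ hQ0
  refine ker_reduction_le q hn hf hX ?_
  have h1 := hle hpQ
  rw [TwoSidedIdeal.mem_ker] at h1
  replace h1 : reduction q n f (MvPolynomial.X 0) (centerHom q n f p) = 0 := h1
  rw [reduction_centerHom, SkewMonoidAlgebra.single_eq_zero] at h1
  have h2 := congrArg (fun d : (Residue (MvPolynomial.X 0 : 𝓒))[T;T⁻¹] => d.coeff 0) h1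
  have h3 : residueHom (MvPolynomial.X 0) p = 0 := by simpa using h2
  have h4 := residueHom_eq_zero_iff.1 h3
  obtain ⟨t, ht⟩ := (hX.associated_of_dvd hp h4).symm.dvd
  rw [ht, map_mul]
  exact Q.mul_mem_right _ _ hpQ

theorem isChattersUFD : IsChattersUFD 𝓡 where
  isDomain := isDomain q hn hf
  left_noetherian := AmbiskewAlgebra.isNoetherianRing _ _ _
  right_noetherian := AmbiskewAlgebra.isNoetherianRing_op _ _ _
  exists_heightOne := ⟨_, isHeightOnePrime_ker_reduction_X q hn hf hq⟩
  heightOne_principal := by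
    intro P hP
    have := isDomain q hn hf
    have hPp := hP.choose
    obtain ⟨h0, hmin⟩ := (TwoSidedIdeal.isHeightOnePrime_iff hPp).1 hP
    obtain ⟨p, hp, hpP⟩ := exists_prime_mem q hn hf hq hPp h0
    -- `P` contains the non-zero prime `pR`, so minimality gives equality; centrality of `p` then
    -- yields `pR = Rp`.
    obtain rfl := hmin _ (isPrimeIdeal_ker_reduction q n f hp) (ker_reduction_ne_bot q hn hf hp)
      (ker_reduction_le q hn hf hp hpP)
    refine ⟨isDomain_quotient_ker_reduction q n f hp, centerHom q n f p,
      mem_ker_reduction_iff q hn hf hp, fun a => ?_⟩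
    simp only [← centerHom_mul_comm]
    exact mem_ker_reduction_iff q hn hf hp a

end AugmentedDownUpAlgebra

/-- Let `K` be a field, `q` a nonzero element of `K` that is not a root of unity, `n` a nonzero
integer and `f` a Laurent polynomial over `K` whose coefficient of degree `n` is zero. -/
theorem proposition2p11 {K : Type*} [Field K] (q : Kˣ) (hq : ∀ m : ℕ, 0 < m → q ^ m ≠ 1)
    (n : ℤ) (hn : n ≠ 0) (f : LaurentPolynomial K) (hf : f.coeff n = 0) :
    -- the centre is the polynomial algebra `K[c, z]`
    (∃ e : MvPolynomial (Fin 2) K ≃ₐ[K] Subalgebra.center K (AugmentedDownUpAlgebra q n f),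
      (e (MvPolynomial.X 0) : AugmentedDownUpAlgebra q n f) = AugmentedDownUpAlgebra.c q n f ∧
      (e (MvPolynomial.X 1) : AugmentedDownUpAlgebra q n f) = AugmentedDownUpAlgebra.z q n f) ∧
    -- every nonzero ideal meets the centre nontrivially
    (∀ I : TwoSidedIdeal (AugmentedDownUpAlgebra q n f), I ≠ ⊥ →
      ∃ r ∈ I, r ∈ Subring.center (AugmentedDownUpAlgebra q n f) ∧ r ≠ 0) ∧
    -- the localization at the set of nonzero central elements is simple
    (∃ S : Submonoid (Subring.center (AugmentedDownUpAlgebra q n f)),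
      (∀ s, s ∈ S ↔ s ≠ 0) ∧
      IsSimpleRing (LocalizedModule S (AugmentedDownUpAlgebra q n f))) ∧
    -- the algebra is a noncommutative unique factorization domain
    IsChattersUFD (AugmentedDownUpAlgebra q n f) := by
  -- `α` scales `k` by `q²` and its inverse by `q⁻²`, so integral powers of `q²` are what matter.
  have hq' : ∀ m : ℤ, m ≠ 0 → (q ^ 2) ^ m ≠ 1 := by
    intro m hm h
    have h1 : q ^ (2 * m) = 1 := by rw [zpow_mul]; exact h
    refine hq (2 * m).natAbs (by omega) ?_
    rcases Int.natAbs_eq (2 * m) with he | he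
    · rwa [he, zpow_natCast] at h1
    · rwa [he, zpow_neg, inv_eq_one, zpow_natCast] at h1
  have := AugmentedDownUpAlgebra.isDomain q hn hf
  have hideal : ∀ I : TwoSidedIdeal (AugmentedDownUpAlgebra q n f), I ≠ ⊥ →
      ∃ r ∈ I, r ∈ Subring.center (AugmentedDownUpAlgebra q n f) ∧ r ≠ 0 := by
    intro I hI
    obtain ⟨s, hs, hsI⟩ := AugmentedDownUpAlgebra.exists_centerHom_mem_of_ne_bot q hn hf hq' I hI
    exact ⟨_, hsI, (AugmentedDownUpAlgebra.centerHom q n f s).2,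
      AugmentedDownUpAlgebra.centerHom_ne_zero q n f hs⟩
  refine ⟨⟨AlgEquiv.ofBijective (AugmentedDownUpAlgebra.centerHom q n f)
    ⟨AugmentedDownUpAlgebra.centerHom_injective q n f,
      AugmentedDownUpAlgebra.centerHom_surjective q hn hf hq'⟩,
    AugmentedDownUpAlgebra.centerHom_X_zero q n f, AugmentedDownUpAlgebra.centerHom_X_one q n f⟩,
    hideal, ⟨nonZeroDivisors _, fun s => mem_nonZeroDivisors_iff_ne_zero, ?_⟩,
    AugmentedDownUpAlgebra.isChattersUFD q hn hf hq'⟩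
  exact LocalizedModule.isSimpleRing_of_center _ (fun s => mem_nonZeroDivisors_iff_ne_zero) hideal
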